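/- **Definitions.** A (Čech) closure space is a set $X$ with a map $c:\mathcal P(X)\to\mathcal P(X)$ such that $c(\emptyset)=\emptyset$, $S\subseteq c(S)$ and $c(S\cup T)=c(S)\cup c(T)$. Its interior operation is $i(S)=X\setminus c(X\setminus S)$; a subset $A\subseteq X$ carries the closure $S\mapsto c(S)\cap A$. A map $f:(X,c)\to(Y,d)$ is continuous if $f(c(S))\subseteq d(f(S))$ for all $S\subseteq X$. A family $\mathcal U$ of subsets of $X$ is an interior cover if $X=\bigcup_{U\in\mathcal U} i(U)$. In a product $\prod_k X_k$ of closure spaces, $x\in c(S)$ if and only if $S$ meets every set $\bigcap_{k\in F}\pi_k^{-1}(V_k)$ with $F$ finite and $x_k\in i(V_k)$ for $k\in F$. Let $J\in\{I,J_+,J_1\}$, where $I=[0,1]$ has its usual topological closure, $J_+=\{0,1\}$ has $c(\{0\})=\{0,1\}$, $c(\{1\})=\{1\}$, and $J_1=\{0,1\}$ is indiscrete (the closure of every nonempty set is the whole set). Let $|\Delta^n|^J$ be the standard topological $n$-simplex if $J=I$; the set $\{0,\dots,n\}$ with $c(S)=\{j : j\ge k\text{ for some }k\in S\}$ if $J=J_+$;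 and the indiscrete space $\{0,\dots,n\}$ if $J=J_1$. Let $J^{\times n}$ be the $n$-fold product closure space (a point if $n=0$). For a closure space $X$: * $H_n^{J}(X)$, $n\ge 0$, is the homology of the complex whose $n$-th group is free abelian on the continuous maps $\sigma:|\Delta^n|^J\to X$, with boundary $\partial\sigma=\sum_{k=0}^n(-1)^k\,\sigma\circ d^k$, where $d^k:|\Delta^{n-1}|^J\to|\Delta^n|^J$ is the $k$-th coface map. * $H_n^{(J,\times)}(X)$, $n\ge 0$, is the homology of the normalized cubical complex $N_\bullet$. Let $Q_n$ be free abelian on the continuous maps $\sigma:J^{\times n}\to X$, and let $d_{k,\varepsilon}:Q_n\to Q_{n-1}$ ($1\le k\le n$, $\varepsilon\in\{0,1\}$) be given by $(d_{k,\varepsilon}\sigma)(a_1,\dots,a_{n-1})=\sigma(a_1,\dots,a_{k-1},\varepsilon,a_k,\dots,a_{n-1})$. Then $N_0=Q_0$, $N_n=\bigcap_{k=1}^n\ker d_{k,1}$ for $n>0$, and $\partial=\sum_{k=1}^n(-1)^{k+1}d_{k,0}$. Both are functors of $X$ by composition with continuous maps. **Theorem (Mayer–Vietoris).** Let $J\in\{I,J_+,J_1\}$,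 let $X$ be a closure space and let $\{A,B\}$ be an interior cover of $X$, that is, $X=i(A)\cup i(B)$. Then for $H=H^{J}$ and for $H=H^{(J,\times)}$ there are homomorphisms $\delta_n:H_{n+1}(X)\to H_n(A\cap B)$, $n\ge 0$, such that the sequence $$\cdots\to H_n(A\cap B)\xrightarrow{\varphi_n}H_n(A)\oplus H_n(B)\xrightarrow{\psi_n}H_n(X)\xrightarrow{\delta_{n-1}}H_{n-1}(A\cap B)\to\cdots\to H_0(A)\oplus H_0(B)\xrightarrow{\psi_0}H_0(X)\to 0$$ is exact, where $\varphi_n(x)=(i_*x,-j_*x)$ and $\psi_n(x,y)=k_*x+l_*y$ for the inclusions $i:A\cap B\to A$, $j:A\cap B\to B$, $k:A\to X$, $l:B\to X$. -/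

import Mathlib

open CategoryTheory

universe u v w

/-! ### Closure spaces -/

/-- A Čech closure space: a set with a closure operation. Idempotence is not required. -/
class ClosureSpace (X : Type u) where
  cl : Set X → Set X
  cl_empty : cl ∅ = ∅
  subset_cl : ∀ A, A ⊆ cl A
  cl_union : ∀ A B, cl (A ∪ B) = cl A ∪ cl B

namespace ClosureSpace

/-- The interior operation `i(A) = X - c(X - A)`. -/
def int {X : Type u} [ClosureSpace X] (A : Set X) : Set X := (cl Aᶜ)ᶜ

/-- An interior cover: every point has a neighbourhood belonging to the family. -/
def IsInteriorCover {X : Type u} [ClosureSpace X] (𝒰 : Set (Set X)) : Prop :=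
  ⋃ U ∈ 𝒰, int U = Set.univ

/-- Continuity of a map of closure spaces: `f(c(A)) ⊆ d(f(A))` for all `A`. -/
def Cont {X : Type u} {Y : Type v} [ClosureSpace X] [ClosureSpace Y] (f : X → Y) : Prop :=
  ∀ A : Set X, f '' cl A ⊆ cl (f '' A)

theorem cl_mono {X : Type u} [ClosureSpace X] {A B : Set X} (h : A ⊆ B) : cl A ⊆ cl B := by
  have := cl_union A B
  rw [Set.union_eq_self_of_subset_left h] at this
  rw [this]
  exact Set.subset_union_left

theorem int_subset {X : Type u} [ClosureSpace X] (A : Set X) : int A ⊆ A := by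
  intro x hx
  by_contra h
  exact hx (subset_cl _ h)

theorem int_mono {X : Type u} [ClosureSpace X] {A B : Set X} (h : A ⊆ B) : int A ⊆ int B :=
  Set.compl_subset_compl.2 (cl_mono (Set.compl_subset_compl.2 h))

theorem int_univ {X : Type u} [ClosureSpace X] : int (Set.univ : Set X) = Set.univ := by
  simp [int, cl_empty]

theorem int_inter {X : Type u} [ClosureSpace X] (A B : Set X) :
    int (A ∩ B) = int A ∩ int B := by
  simp [int, Set.compl_inter, cl_union]

theorem mem_cl_iff {X : Type u} [ClosureSpace X] {A : Set X} {x : X} :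
    x ∈ cl A ↔ ∀ U : Set X, x ∈ int U → ∃ y ∈ A, y ∈ U := by
  constructor
  · intro hx U hU
    by_contra! h
    exact hU (cl_mono (fun y hy => h y hy) hx)
  · intro h
    by_contra hx
    obtain ⟨y, hy, hy'⟩ := h Aᶜ (by simpa [int] using hx)
    exact hy' hy

theorem Cont.preimage {X : Type u} {Y : Type v} [ClosureSpace X] [ClosureSpace Y] {f : X → Y}
    (hf : Cont f) {V : Set Y} {x : X} (h : f x ∈ int V) : x ∈ int (f ⁻¹' V) := by
  intro hx
  refine h (cl_mono ?_ (hf _ ⟨x, hx, rfl⟩))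
  rintro _ ⟨y, hy, rfl⟩
  exact hy

theorem Cont.comp {X : Type u} {Y : Type v} {Z : Type w} [ClosureSpace X] [ClosureSpace Y]
    [ClosureSpace Z] {g : Y → Z} {f : X → Y} (hg : Cont g) (hf : Cont f) : Cont (g ∘ f) := by
  intro A
  rw [Set.image_comp, Set.image_comp]
  exact (Set.image_mono (hf A)).trans (hg _)

theorem Cont.id {X : Type u} [ClosureSpace X] : Cont (fun x : X => x) := by
  intro A
  simp

theorem Cont.const {X : Type u} {Y : Type v} [ClosureSpace X] [ClosureSpace Y] (y : Y) :
    Cont (fun _ : X => y) := by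
  rintro A _ ⟨x, hx, rfl⟩
  rcases A.eq_empty_or_nonempty with rfl | ⟨a, ha⟩
  · simp [cl_empty] at hx
  · exact subset_cl _ ⟨a, ha, rfl⟩

/-- The subspace closure `c_A(S) = c(S) ∩ A`. -/
instance subspace {X : Type u} [ClosureSpace X] (A : Set X) : ClosureSpace A where
  cl S := Subtype.val ⁻¹' cl (Subtype.val '' S)
  cl_empty := by simp [cl_empty]
  subset_cl S x hx := subset_cl _ ⟨x, hx, rfl⟩
  cl_union S T := by rw [Set.image_union, cl_union, Set.preimage_union]

/-- The closure operation of a topological space. -/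
@[reducible]
def ofTopology (X : Type u) [TopologicalSpace X] : ClosureSpace X where
  cl := closure
  cl_empty := closure_empty
  subset_cl _ := subset_closure
  cl_union _ _ := closure_union

/-- The closure operation `c(i) = {j | i ≤ j}` of a preorder. -/
@[reducible]
def ofPreorder (X : Type u) [Preorder X] : ClosureSpace X where
  cl S := {j | ∃ i ∈ S, i ≤ j}
  cl_empty := by simp
  subset_cl S i hi := ⟨i, hi, le_rfl⟩
  cl_union S T := by
    ext j
    simp only [Set.mem_ofPred_eq, Set.mem_union]
    constructor
    · rintro ⟨i, hi | hi, h⟩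
      · exact Or.inl ⟨i, hi, h⟩
      · exact Or.inr ⟨i, hi, h⟩
    · rintro (⟨i, hi, h⟩ | ⟨i, hi, h⟩)
      · exact ⟨i, Or.inl hi, h⟩
      · exact ⟨i, Or.inr hi, h⟩

/-- The indiscrete closure operation: the closure of every nonempty set is the whole space. -/
@[reducible]
def indiscrete (X : Type u) : ClosureSpace X where
  cl S := {_x | S.Nonempty}
  cl_empty := by simp
  subset_cl S i hi := ⟨i, hi⟩
  cl_union S T := by
    ext j
    simp [Set.union_nonempty]

/-- The product closure: the sets `⋂_{i ∈ F} πᵢ⁻¹(Vᵢ)`, with `F` finite and `Vᵢ` a neighbourhood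
of `xᵢ`, form a local base at `x`, and `x` is in the closure of `S` iff all of them meet `S`. -/
instance pi {ι : Type v} (X : ι → Type u) [∀ i, ClosureSpace (X i)] :
    ClosureSpace (∀ i, X i) where
  cl S := {x | ∀ (F : Finset ι) (V : ∀ i, Set (X i)), (∀ i ∈ F, x i ∈ int (V i)) →
    ∃ y ∈ S, ∀ i ∈ F, y i ∈ V i}
  cl_empty := by
    ext x
    simp only [Set.mem_ofPred_eq, Set.mem_empty_iff_false, false_and, exists_false, iff_false]
    intro h
    exact h ∅ (fun _ => Set.univ) (by simp)
  subset_cl S x hx F V hV := ⟨x, hx, fun i hi => int_subset _ (hV i hi)⟩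
  cl_union S T := by
    classical
    ext x
    constructor
    · intro h
      by_contra hx
      simp only [Set.mem_union, Set.mem_ofPred_eq, not_or, not_forall] at hx
      obtain ⟨⟨F, V, hV, hF⟩, ⟨G, W, hW, hG⟩⟩ := hx
      obtain ⟨y, hy, hyV⟩ := h (F ∪ G)
        (fun i => (if i ∈ F then V i else Set.univ) ∩ (if i ∈ G then W i else Set.univ)) (by
          intro i _
          rw [int_inter]
          constructor
          · split_ifs with h1
            · exact hV i h1
            · rw [int_univ]; trivial
          · split_ifs with h1
            · exact hW i h1
            · rw [int_univ]; trivial)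
      rcases hy with hy | hy
      · refine hF ⟨y, hy, fun i hi => ?_⟩
        have := (hyV i (Finset.mem_union_left _ hi)).1
        rwa [if_pos hi] at this
      · refine hG ⟨y, hy, fun i hi => ?_⟩
        have := (hyV i (Finset.mem_union_right _ hi)).2
        rwa [if_pos hi] at this
    · rintro (h | h) F V hV
      · obtain ⟨y, hy, h'⟩ := h F V hV
        exact ⟨y, Or.inl hy, h'⟩
      · obtain ⟨y, hy, h'⟩ := h F V hV
        exact ⟨y, Or.inr hy, h'⟩

theorem Cont.eval {ι : Type v} {X : ι → Type u} [∀ i, ClosureSpace (X i)] (i : ι) :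
    Cont (fun x : ∀ i, X i => x i) := by
  classical
  rintro A _ ⟨x, hx, rfl⟩
  rw [mem_cl_iff]
  intro U hU
  obtain ⟨y, hy, h⟩ := hx {i} (Function.update (fun _ => Set.univ) i U) (by simpa using hU)
  exact ⟨y i, ⟨y, hy, rfl⟩, by simpa using h⟩

theorem Cont.toPi {ι : Type v} {X : ι → Type u} [∀ i, ClosureSpace (X i)] {Z : Type w}
    [ClosureSpace Z] {f : Z → ∀ i, X i} (hf : ∀ i, Cont (fun z => f z i)) : Cont f := by
  classical
  rintro A _ ⟨z, hz, rfl⟩ F V hV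
  rw [mem_cl_iff] at hz
  have key : ∀ G : Finset ι, G ⊆ F → z ∈ int {z' | ∀ i ∈ G, f z' i ∈ V i} := by
    intro G
    induction G using Finset.induction_on with
    | empty => intro _; simp [int_univ]
    | insert a s ha ih =>
      intro h
      have h1 := (hf a).preimage (hV a (h (Finset.mem_insert_self _ _)))
      have h2 := ih ((Finset.subset_insert _ _).trans h)
      have h3 : z ∈ int (((fun z => f z a) ⁻¹' V a) ∩ {z' | ∀ i ∈ s, f z' i ∈ V i}) := by
        rw [int_inter]
        exact ⟨h1, h2⟩
      refine int_mono ?_ h3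
      rintro z' ⟨h4, h5⟩ i hi
      rcases Finset.mem_insert.1 hi with rfl | hi
      · exact h4
      · exact h5 i hi
  obtain ⟨y, hy, h⟩ := hz _ (key F subset_rfl)
  exact ⟨f y, ⟨y, hy, rfl⟩, h⟩

end ClosureSpace

open ClosureSpace

/-- Continuous maps between closure spaces. -/
@[ext]
structure CMap (X : Type u) (Y : Type v) [ClosureSpace X] [ClosureSpace Y] where
  toFun : X → Y
  cont : Cont toFun

/-- Composition of continuous maps. -/
def CMap.comp {X : Type u} {Y : Type v} {Z : Type w} [ClosureSpace X] [ClosureSpace Y]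
    [ClosureSpace Z] (g : CMap Y Z) (f : CMap X Y) : CMap X Z :=
  ⟨g.toFun ∘ f.toFun, g.cont.comp f.cont⟩

/-- The identity map. -/
def CMap.id (X : Type u) [ClosureSpace X] : CMap X X := ⟨fun x => x, Cont.id⟩

/-- The category `Cl` of closure spaces and continuous maps. -/
structure Cl : Type (u + 1) where
  of ::
  carrier : Type u
  [str : ClosureSpace carrier]

instance : CoeSort Cl.{u} (Type u) := ⟨Cl.carrier⟩

instance (X : Cl.{u}) : ClosureSpace X := X.str

instance : Category Cl.{u} where
  Hom X Y := CMap X Y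
  id X := CMap.id X
  comp f g := CMap.comp g f

/-- The inclusion of nested subspaces. -/
def Cl.incl {X : Type u} [ClosureSpace X] {A B : Set X} (h : A ⊆ B) :
    Cl.of A ⟶ Cl.of B where
  toFun x := ⟨x.1, h x.2⟩
  cont := by
    rintro S _ ⟨x, hx, rfl⟩
    have hx' : x.1 ∈ cl (Subtype.val '' S) := hx
    change x.1 ∈ cl (Subtype.val '' _)
    refine cl_mono ?_ hx'
    rintro _ ⟨y, hy, rfl⟩
    exact ⟨⟨y.1, h y.2⟩, ⟨y, hy, rfl⟩, rfl⟩

/-- The inclusion of a subspace. -/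
def Cl.val {X : Type u} [ClosureSpace X] (A : Set X) : Cl.of A ⟶ Cl.of X where
  toFun x := x.1
  cont := by
    rintro S _ ⟨x, hx, rfl⟩
    exact hx

/-- The inclusion of topological spaces in closure spaces. -/
def topToCl : TopCat.{u} ⥤ Cl.{u} where
  obj Y := @Cl.of Y (ofTopology Y)
  map {Y Z} f := @CMap.mk Y Z (ofTopology Y) (ofTopology Z) f
    (fun _ => image_closure_subset_closure_image f.hom.continuous)

/-- The three intervals: the unit interval `I`, the directed edge `J₊`, the undirected edge `J₁`. -/
inductive CInterval
  | I
  | Jplus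
  | Jone

/-! ### Singular simplicial homology -/

/-- The cosimplicial closure space `[n] ↦ |Δⁿ|^J`: the standard topological simplex for `J = I`,
the set `{0, …, n}` with closure `c(i) = {j | i ≤ j}` for `J = J₊`, and the indiscrete space
`{0, …, n}` for `J = J₁`. -/
noncomputable def CInterval.simplex : CInterval → SimplexCategory ⥤ Cl.{0}
  | .I => SimplexCategory.toTop₀ ⋙ topToCl
  | .Jplus =>
    { obj := fun n => @Cl.of (Fin (n.len + 1)) (ofPreorder _)
      map := fun {m n} f =>
        @CMap.mk _ _ (ofPreorder _) (ofPreorder _) (fun i => f i) (by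
          rintro A _ ⟨j, ⟨i, hi, h⟩, rfl⟩
          exact ⟨f i, ⟨i, hi, rfl⟩, f.toOrderHom.monotone h⟩)
      map_id := by intros; rfl
      map_comp := by intros; rfl }
  | .Jone =>
    { obj := fun n => @Cl.of (Fin (n.len + 1)) (indiscrete _)
      map := fun {m n} f =>
        @CMap.mk _ _ (indiscrete _) (indiscrete _) (fun i => f i) (by
          rintro A _ ⟨j, ⟨i, hi⟩, rfl⟩
          exact ⟨f i, i, hi, rfl⟩)
      map_id := by intros; rfl
      map_comp := by intros; rfl }

/-- The `J` nerve: the simplicial set of continuous maps `|Δⁿ|^J → X`. -/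
noncomputable def singularSet (J : CInterval) : Cl.{u} ⥤ SSet.{u} where
  obj X :=
    { obj := fun n => CMap (J.simplex.obj n.unop) X
      map := fun f => TypeCat.ofHom (fun σ => σ.comp (J.simplex.map f.unop))
      map_id := by
        intro n
        ext σ
        simp only [unop_id, CategoryTheory.Functor.map_id]
        rfl
      map_comp := by
        intro l m n f g
        ext σ
        simp
        rfl }
  map f := { app := fun n => TypeCat.ofHom (fun σ => CMap.comp f σ) }

/-- The free abelian group functor. -/
noncomputable def freeZ : Type u ⥤ ModuleCat.{u} ℤ where
  obj S := ModuleCat.of ℤ (S →₀ ℤ)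
  map f := ModuleCat.ofHom (Finsupp.lmapDomain ℤ ℤ f)
  map_id S := by
    ext : 1
    exact Finsupp.lmapDomain_id ℤ ℤ
  map_comp f g := by
    ext : 1
    exact Finsupp.lmapDomain_comp ℤ ℤ f g

/-- The singular simplicial chain complex: the Moore complex of the free simplicial abelian group
on the `J` nerve. -/
noncomputable def simplicialChains (J : CInterval) : Cl.{u} ⥤ ChainComplex (ModuleCat.{u} ℤ) ℕ :=
  singularSet J ⋙ (SimplicialObject.whiskering _ _).obj freeZ ⋙
    AlgebraicTopology.alternatingFaceMapComplex _

/-! ### Singular cubical homology -/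

/-- The interval `J` as a closure space. -/
def CInterval.space : CInterval → Cl.{0}
  | .I => @Cl.of unitInterval (ofTopology _)
  | .Jplus => @Cl.of (Fin 2) (ofPreorder _)
  | .Jone => @Cl.of (Fin 2) (indiscrete _)

/-- The end points `0` and `1` of the interval `J`. -/
def CInterval.endpoint : (J : CInterval) → Fin 2 → J.space
  | .I => fun ε => if ε = 0 then (0 : unitInterval) else (1 : unitInterval)
  | .Jplus => fun ε => ε
  | .Jone => fun ε => ε

/-- The `n`-cube `J^{×n}`, with the product closure. -/
abbrev CInterval.Cube (J : CInterval) (n : ℕ) : Type := Fin n → J.space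

/-- The inclusion `J^{×n} → J^{×(n+1)}` of the face where the coordinate `i` is the end point `ε`
(coordinates are numbered from `0`). -/
def CInterval.face (J : CInterval) {n : ℕ} (i : Fin (n + 1)) (ε : Fin 2) :
    CMap (J.Cube n) (J.Cube (n + 1)) where
  toFun a := i.insertNth (α := fun _ => J.space) (J.endpoint ε) a
  cont := by
    apply Cont.toPi
    intro k
    rcases Fin.eq_self_or_eq_succAbove i k with rfl | ⟨l, rfl⟩
    · simpa using Cont.const _
    · simpa using Cont.eval (X := fun _ : Fin n => (J.space : Type)) l

/-- The free abelian group on the singular `n`-cubes of `X`. -/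
abbrev CubeChain (J : CInterval) (X : Type u) [ClosureSpace X] (n : ℕ) : Type u :=
  CMap (J.Cube n) X →₀ ℤ

namespace CubeChain

variable (J : CInterval) (X : Type u) [ClosureSpace X]

/-- The face map `d_{i,ε}`, restricting a singular cube to the face `a_i = ε`. -/
noncomputable def d {n : ℕ} (i : Fin (n + 1)) (ε : Fin 2) :
    CubeChain J X (n + 1) →ₗ[ℤ] CubeChain J X n :=
  Finsupp.lmapDomain ℤ ℤ (fun σ => σ.comp (J.face i ε))

/-- The underlying group `⋂ᵢ ker d_{i,1}` of the normalized complex (everything if `n = 0`). -/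
noncomputable def normalized : (n : ℕ) → Submodule ℤ (CubeChain J X n)
  | 0 => ⊤
  | _ + 1 => ⨅ i, LinearMap.ker (d J X i 1)

/-- The map `∑ᵢ (-1)ⁱ d_{i,0}`, coordinates being numbered from `0`. -/
noncomputable def bdry (n : ℕ) : CubeChain J X (n + 1) →ₗ[ℤ] CubeChain J X n :=
  ∑ i : Fin (n + 1), (-1 : ℤ) ^ (i : ℕ) • d J X i 0

variable {J X}

theorem face_face {n : ℕ} {i j : Fin (n + 1)} (h : i ≤ j) (ε δ : Fin 2) :
    (J.face j.succ δ).comp (J.face i ε) = (J.face i.castSucc ε).comp (J.face j δ) := by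
  apply CMap.ext
  funext a k
  simp only [CMap.comp, Function.comp, CInterval.face]
  rcases Fin.eq_self_or_eq_succAbove j.succ k with rfl | ⟨l, rfl⟩
  · have : j.succ = i.castSucc.succAbove j := by
      rw [Fin.succAbove_of_le_castSucc]
      simpa using h
    rw [Fin.insertNth_apply_same, this, Fin.insertNth_apply_succAbove, Fin.insertNth_apply_same]
  · rw [Fin.insertNth_apply_succAbove]
    rcases Fin.eq_self_or_eq_succAbove i l with rfl | ⟨m, rfl⟩
    · have : j.succ.succAbove l = l.castSucc := by
        rw [Fin.succAbove_of_castSucc_lt]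
        simpa [Fin.lt_def, Nat.lt_succ_iff] using h
      rw [this, Fin.insertNth_apply_same, Fin.insertNth_apply_same]
    · have : j.succ.succAbove (i.succAbove m) = i.castSucc.succAbove (j.succAbove m) := by
        simp only [Fin.succAbove, Fin.lt_def, Fin.le_def] at *
        split_ifs <;> simp_all [Fin.ext_iff] <;> omega
      rw [this]
      simp only [Fin.insertNth_apply_succAbove]

theorem d_d {n : ℕ} {i j : Fin (n + 1)} (h : i ≤ j) (ε δ : Fin 2) (c : CubeChain J X (n + 2)) :
    d J X i ε (d J X j.succ δ c) = d J X j δ (d J X i.castSucc ε c) := by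
  simp only [d, Finsupp.lmapDomain_apply, ← Finsupp.mapDomain_comp]
  congr 1
  funext σ
  change CMap.mk _ _ = CMap.mk _ _
  have := congrArg CMap.toFun (face_face (J := J) h ε δ)
  apply CMap.ext
  exact congrArg (σ.toFun ∘ ·) this

theorem exists_d_d {n : ℕ} (i : Fin (n + 1)) (j : Fin (n + 2)) (ε δ : Fin 2) :
    ∃ (i' : Fin (n + 2)) (j' : Fin (n + 1)), ∀ c : CubeChain J X (n + 2),
      d J X i ε (d J X j δ c) = d J X j' δ (d J X i' ε c) := by
  rcases lt_or_ge i.castSucc j with h | h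
  · obtain ⟨k, rfl⟩ := Fin.exists_succ_eq.2 (Fin.ne_zero_of_lt h)
    exact ⟨i.castSucc, k, fun c => d_d (Fin.castSucc_lt_succ_iff.1 h) ε δ c⟩
  · obtain ⟨k, rfl⟩ := Fin.exists_castSucc_eq.2
      (Fin.ne_last_of_lt (lt_of_le_of_lt h (Fin.castSucc_lt_last i)))
    exact ⟨i.succ, k, fun c => (d_d (Fin.castSucc_le_castSucc_iff.1 h) δ ε c).symm⟩

theorem bdry_mem {n : ℕ} {c : CubeChain J X (n + 1)} (hc : c ∈ normalized J X (n + 1)) :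
    bdry J X n c ∈ normalized J X n := by
  cases n with
  | zero => trivial
  | succ n =>
    simp only [normalized, Submodule.mem_iInf, LinearMap.mem_ker] at hc ⊢
    intro i
    simp only [bdry, LinearMap.sum_apply, LinearMap.smul_apply, map_sum, map_smul]
    refine Finset.sum_eq_zero fun j _ => ?_
    obtain ⟨i', j', h⟩ := exists_d_d (J := J) (X := X) i j 1 0
    rw [h, hc, map_zero, smul_zero]

theorem bdry_bdry (n : ℕ) (c : CubeChain J X (n + 2)) :
    bdry J X n (bdry J X (n + 1) c) = 0 := by
  simp only [bdry, LinearMap.sum_apply, LinearMap.smul_apply, map_sum, map_smul, Finset.smul_sum,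
    smul_smul]
  rw [← Finset.sum_product', Finset.univ_product_univ]
  let φ : Fin (n + 2) × Fin (n + 1) → Fin (n + 2) × Fin (n + 1) := fun p =>
    if h : p.2.castSucc < p.1 then (p.2.castSucc, p.1.pred (Fin.ne_zero_of_lt h))
    else (p.2.succ, p.1.castPred
      (Fin.ne_last_of_lt (lt_of_le_of_lt (not_lt.1 h) (Fin.castSucc_lt_last p.2))))
  refine Finset.sum_involution (fun p _ => φ p) ?_ ?_ ?_ ?_
  · rintro ⟨j, i⟩ -
    by_cases h : i.castSucc < j
    · obtain ⟨k, rfl⟩ := Fin.exists_succ_eq.2 (Fin.ne_zero_of_lt h)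
      have hk := Fin.castSucc_lt_succ_iff.1 h
      simp only [φ, dif_pos h, Fin.pred_succ, d_d hk, ← add_smul]
      simp [pow_succ, mul_comm]
    · obtain ⟨k, rfl⟩ := Fin.exists_castSucc_eq.2
        (Fin.ne_last_of_lt (lt_of_le_of_lt (not_lt.1 h) (Fin.castSucc_lt_last i)))
      have hk := Fin.castSucc_le_castSucc_iff.1 (not_lt.1 h)
      simp only [φ, dif_neg h, Fin.castPred_castSucc, d_d hk, ← add_smul]
      simp [pow_succ, mul_comm]
  · rintro ⟨j, i⟩ - - h
    by_cases h' : i.castSucc < j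
    · simp only [φ, dif_pos h', Prod.mk.injEq] at h
      exact h'.ne h.1
    · simp only [φ, dif_neg h', Prod.mk.injEq] at h
      apply h'
      rw [← h.1]
      exact Fin.castSucc_lt_succ
  · intros
    exact Finset.mem_univ _
  · rintro ⟨j, i⟩ -
    by_cases h : i.castSucc < j
    · obtain ⟨k, rfl⟩ := Fin.exists_succ_eq.2 (Fin.ne_zero_of_lt h)
      have hk := Fin.castSucc_lt_succ_iff.1 h
      have : ¬ k.castSucc < i.castSucc := by simpa using hk
      simp [φ, h, this]
    · obtain ⟨k, rfl⟩ := Fin.exists_castSucc_eq.2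
        (Fin.ne_last_of_lt (lt_of_le_of_lt (not_lt.1 h) (Fin.castSucc_lt_last i)))
      have hk := Fin.castSucc_le_castSucc_iff.1 (not_lt.1 h)
      have : k.castSucc < i.succ := Fin.castSucc_lt_succ_iff.2 hk
      simp [φ, h, this]

/-- The map of cubical chains induced by a continuous map. -/
noncomputable def map {Y : Type v} [ClosureSpace Y] (f : CMap X Y) (n : ℕ) :
    CubeChain J X n →ₗ[ℤ] CubeChain J Y n :=
  Finsupp.lmapDomain ℤ ℤ (fun σ => f.comp σ)

theorem d_map {Y : Type v} [ClosureSpace Y] (f : CMap X Y) {n : ℕ} (i : Fin (n + 1)) (ε : Fin 2)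
    (c : CubeChain J X (n + 1)) : d J Y i ε (map f _ c) = map f _ (d J X i ε c) := by
  simp only [d, map, Finsupp.lmapDomain_apply, ← Finsupp.mapDomain_comp]
  rfl

theorem map_mem {Y : Type v} [ClosureSpace Y] (f : CMap X Y) {n : ℕ} {c : CubeChain J X n}
    (hc : c ∈ normalized J X n) : map f n c ∈ normalized J Y n := by
  cases n with
  | zero => trivial
  | succ n =>
    simp only [normalized, Submodule.mem_iInf, LinearMap.mem_ker] at hc ⊢
    intro i
    rw [d_map, hc, map_zero]

theorem bdry_map {Y : Type v} [ClosureSpace Y] (f : CMap X Y) (n : ℕ)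
    (c : CubeChain J X (n + 1)) : bdry J Y n (map f _ c) = map f _ (bdry J X n c) := by
  simp only [bdry, LinearMap.sum_apply, LinearMap.smul_apply, map_sum, map_smul, d_map]

end CubeChain

/-- The `(J, ×)` singular cubical chain complex: the normalized complex of the free cubical abelian
group on the continuous maps `J^{×n} → X`. -/
noncomputable def cubicalChains (J : CInterval) : Cl.{u} ⥤ ChainComplex (ModuleCat.{u} ℤ) ℕ where
  obj X := ChainComplex.of (fun n => ModuleCat.of ℤ (CubeChain.normalized J X n))
    (fun n => ModuleCat.ofHom
      ((CubeChain.bdry J X n).restrict (fun _ hc => CubeChain.bdry_mem hc)))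
    (fun n => by
      apply ModuleCat.hom_ext
      apply LinearMap.ext
      intro c
      apply Subtype.ext
      exact CubeChain.bdry_bdry n c.1)
  map {X Y} f := ChainComplex.ofHom
    (fun n => ModuleCat.ofHom
      ((CubeChain.map f n).restrict (fun _ hc => CubeChain.map_mem f hc)))
    (fun n => by
      simp only [ChainComplex.of_d]
      apply ModuleCat.hom_ext
      apply LinearMap.ext
      intro c
      apply Subtype.ext
      exact CubeChain.bdry_map f n c.1)
  map_id X := by
    apply HomologicalComplex.hom_ext
    intro n
    apply ModuleCat.hom_ext
    apply LinearMap.ext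
    intro c
    apply Subtype.ext
    exact congrArg (fun g : _ →ₗ[ℤ] _ => g c.1) (Finsupp.lmapDomain_id ℤ ℤ)
  map_comp {X Y Z} f g := by
    apply HomologicalComplex.hom_ext
    intro n
    apply ModuleCat.hom_ext
    apply LinearMap.ext
    intro c
    apply Subtype.ext
    exact congrArg (fun h : _ →ₗ[ℤ] _ => h c.1)
      (Finsupp.lmapDomain_comp ℤ ℤ (fun σ => CMap.comp f σ) (fun σ => CMap.comp g σ))

/-! ### Mayer–Vietoris sequences -/

section MayerVietoris

/-- The `n`-th homology group of `X` for the chain complex functor `C`. -/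
noncomputable abbrev Hlgy (C : Cl.{u} ⥤ ChainComplex (ModuleCat.{u} ℤ) ℕ) (n : ℕ) (X : Type u)
    [ClosureSpace X] : ModuleCat.{u} ℤ :=
  (C.obj (Cl.of X)).homology n

/-- The homomorphism induced in homology by a continuous map. -/
noncomputable def Hlgy.map (C : Cl.{u} ⥤ ChainComplex (ModuleCat.{u} ℤ) ℕ) (n : ℕ) {X Y : Type u}
    [ClosureSpace X] [ClosureSpace Y] (f : Cl.of X ⟶ Cl.of Y) : Hlgy C n X →+ Hlgy C n Y :=
  (HomologicalComplex.homologyMap (C.map f) n).hom.toAddMonoidHom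

variable (C : Cl.{u} ⥤ ChainComplex (ModuleCat.{u} ℤ) ℕ) {X : Type u} [ClosureSpace X]
  (A B : Set X)

/-- The map `Hₙ(A ∩ B) → Hₙ(A) ⊕ Hₙ(B)`, `x ↦ (x, -x)`. -/
noncomputable def mvDiff (n : ℕ) :
    Hlgy C n (A ∩ B : Set X) →+ Hlgy C n A × Hlgy C n B :=
  (Hlgy.map C n (Cl.incl Set.inter_subset_left)).prod
    (-Hlgy.map C n (Cl.incl Set.inter_subset_right))

/-- The map `Hₙ(A) ⊕ Hₙ(B) → Hₙ(X)`, `(x, y) ↦ x + y`. -/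
noncomputable def mvSum (n : ℕ) : Hlgy C n A × Hlgy C n B →+ Hlgy C n X :=
  (Hlgy.map C n (Cl.val A)).coprod (Hlgy.map C n (Cl.val B))

/-- There are connecting maps `Hₙ₊₁(X) → Hₙ(A ∩ B)` that make the sequence
`⋯ → Hₙ(A ∩ B) → Hₙ(A) ⊕ Hₙ(B) → Hₙ(X) → Hₙ₋₁(A ∩ B) → ⋯ → H₀(A) ⊕ H₀(B) → H₀(X) → 0` exact. -/
def HasMayerVietorisSequence : Prop :=
  ∃ δ : ∀ n : ℕ, Hlgy C (n + 1) X →+ Hlgy C n (A ∩ B : Set X),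
    (∀ n, Function.Exact (mvDiff C A B n) (mvSum C A B n)) ∧
    (∀ n, Function.Exact (mvSum C A B (n + 1)) (δ n)) ∧
    (∀ n, Function.Exact (δ n) (mvDiff C A B n)) ∧
    Function.Surjective (mvSum C A B 0)

end MayerVietoris

/-! For either chain functor `C`, the maps `C(A ∩ B) → C(A) ⊕ C(B) → C(X)` form a short exact
sequence except at the right end, where the image is the group of small chains, those that are sums
of a chain of `A` and a chain of `B`. The theorem therefore reduces to the acyclicity of `C(X)`
modulo small chains (`hasMayerVietorisSequence_of_acyclic`): a chain with small boundary becomes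
small after subtracting a boundary.

For `J₊` and `J₁` every chain is small. Each simplex and each cube has a point `p` in the closure of
every singleton, so a neighbourhood of `σ p` contains the whole image of `σ`, and one of `A`, `B` is
such a neighbourhood (`CMap.mem_small_of_forall_mem_cl`).

For `I` a subdivision operator is iterated. It is a chain map, homotopic to the identity by a
homotopy that preserves small chains, and some iterate makes any given chain small;
`ChainComplex.acyclic_of_subdivision` draws the conclusion. Smallness comes from a Lebesgue number
on the compact metric domain (`ClosureSpace.IsInteriorCover.exists_lebesgue_number`): continuity
pulls neighbourhoods in `X` back to topological neighbourhoods, so the closure of `X` need not be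
idempotent. Simplices are subdivided barycentrically, with the algebra carried out on tuples of
points. Cubes are subdivided coordinate by coordinate, replacing `I` by left half minus midpoint
plus right half. This commutes with all faces and so preserves normalized chains. In the cubical
case a small normalized chain must also be split into normalized chains of `A` and `B`
(`CubeChain.exists_normalized`). -/

open CategoryTheory.Limits

/-! ### Homological algebra: long exact sequences up to an acyclic cokernel, and subdivision. -/

namespace ChainComplex

variable {K L M : ChainComplex (ModuleCat.{u} ℤ) ℕ}

/-- Subtraction is truncated: for `n = 0` the condition concerns `K.d 0 0`, which is zero, so one
formulation covers all degrees. The same convention is used in the acyclicity hypotheses below. -/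
theorem exists_cycle (n : ℕ) (x : K.X n) (hx : K.d n (n - 1) x = 0) :
    ∃ z : K.cycles n, K.iCycles n z = x := by
  have hnext : (ComplexShape.down ℕ).next n = n - 1 := by cases n <;> simp
  have ex : (ShortComplex.mk (K.iCycles n) (K.d n (n - 1)) (by simp)).Exact :=
    ShortComplex.exact_of_f_is_kernel _ (K.cyclesIsKernel n (n - 1) hnext)
  exact ((ShortComplex.moduleCat_exact_iff _).1 ex) x hx

theorem homologyπ_eq_zero_iff (n : ℕ) (z : K.cycles n) :
    K.homologyπ n z = 0 ↔ ∃ w : K.X (n + 1), K.d (n + 1) n w = K.iCycles n z := by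
  have ex : (ShortComplex.mk (K.toCycles (n + 1) n) (K.homologyπ n) (by simp)).Exact :=
    ShortComplex.exact_of_g_is_cokernel _ (K.homologyIsCokernel (n + 1) n (by simp))
  have inj : Function.Injective (K.iCycles n) := (ModuleCat.mono_iff_injective _).1 inferInstance
  constructor
  · intro h
    obtain ⟨w, hw⟩ := ((ShortComplex.moduleCat_exact_iff _).1 ex) z h
    refine ⟨w, ?_⟩
    rw [← hw]
    exact (ConcreteCategory.congr_hom (K.toCycles_i (n + 1) n) w).symm
  · rintro ⟨w, hw⟩
    have : K.toCycles (n + 1) n w = z :=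
      inj ((ConcreteCategory.congr_hom (K.toCycles_i (n + 1) n) w).trans hw)
    rw [← this]
    exact ConcreteCategory.congr_hom (K.toCycles_comp_homologyπ (n + 1) n) w

theorem exists_homologyπ_eq (n : ℕ) (h : K.homology n) : ∃ z : K.cycles n, K.homologyπ n z = h :=
  (ModuleCat.epi_iff_surjective (K.homologyπ n)).1 inferInstance h

theorem d_iCycles (n m : ℕ) (z : K.cycles n) : K.d n m (K.iCycles n z) = 0 :=
  ConcreteCategory.congr_hom (K.iCycles_d n m) z

theorem d_comm (f : K ⟶ L) (n m : ℕ) (x : K.X n) : L.d n m (f.f n x) = f.f m (K.d n m x) :=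
  ConcreteCategory.congr_hom (f.comm n m) x

/-- A degreewise injective map of complexes whose cokernel is acyclic is bijective in homology. -/
theorem homologyMap_bijective (f : K ⟶ L) (inj : ∀ n, Function.Injective (f.f n))
    (acyclic : ∀ (n : ℕ) (z : L.X n), L.d n (n - 1) z ∈ Set.range (f.f (n - 1)) →
      ∃ w : L.X (n + 1), z - L.d (n + 1) n w ∈ Set.range (f.f n)) (n : ℕ) :
    Function.Bijective (HomologicalComplex.homologyMap f n) := by
  have hπ : ∀ z : K.cycles n, HomologicalComplex.homologyMap f n (K.homologyπ n z) =
      L.homologyπ n (HomologicalComplex.cyclesMap f n z) := fun z =>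
    ConcreteCategory.congr_hom (HomologicalComplex.homologyπ_naturality f n) z
  have hi : ∀ z : K.cycles n, L.iCycles n (HomologicalComplex.cyclesMap f n z) =
      f.f n (K.iCycles n z) := fun z =>
    ConcreteCategory.congr_hom (HomologicalComplex.cyclesMap_i f n) z
  constructor
  · rw [injective_iff_map_eq_zero]
    intro h h0
    obtain ⟨z, rfl⟩ := exists_homologyπ_eq n h
    rw [hπ, homologyπ_eq_zero_iff] at h0
    obtain ⟨w, hw⟩ := h0
    rw [hi] at hw
    -- The chain `w` bounds the image of `z`, so its boundary lies in the range of `f`; corrected by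
    -- a boundary, `w` comes from some `s`, and `s` bounds `z`.
    obtain ⟨w', s, hs⟩ := acyclic (n + 1) w ⟨_, hw.symm⟩
    rw [homologyπ_eq_zero_iff]
    refine ⟨s, inj n ?_⟩
    have hdd : L.d (n + 1) n (L.d (n + 1 + 1) (n + 1) w') = 0 :=
      ConcreteCategory.congr_hom (L.d_comp_d (n + 1 + 1) (n + 1) n) w'
    rw [← hw, ← d_comm, hs, map_sub, hdd, sub_zero]
  · intro h
    obtain ⟨z, rfl⟩ := exists_homologyπ_eq n h
    obtain ⟨w, s, hs⟩ := acyclic n (L.iCycles n z) ⟨0, by rw [map_zero, d_iCycles]⟩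
    have hdd : L.d n (n - 1) (L.d (n + 1) n w) = 0 :=
      ConcreteCategory.congr_hom (L.d_comp_d (n + 1) n (n - 1)) w
    -- Since `f` is injective in degree `n - 1`, the preimage `s` of a cycle is a cycle.
    obtain ⟨y, hy⟩ := exists_cycle n s (inj (n - 1) (by
      rw [map_zero, ← d_comm, hs, map_sub, d_iCycles, hdd, sub_zero]))
    refine ⟨K.homologyπ n y, ?_⟩
    rw [hπ, ← sub_eq_zero, ← map_sub, homologyπ_eq_zero_iff]
    refine ⟨-w, ?_⟩
    rw [map_sub, hi, hy, hs, map_neg]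
    abel

/-- The long exact sequence of a sequence `0 → K → L → M` of complexes that is exact up to an
acyclic cokernel on the right. -/
theorem exists_long_exact_sequence (f : K ⟶ L) (g : L ⟶ M)
    (inj : ∀ n, Function.Injective (f.f n)) (ex : ∀ n, Function.Exact (f.f n) (g.f n))
    (acyclic : ∀ (n : ℕ) (z : M.X n), M.d n (n - 1) z ∈ Set.range (g.f (n - 1)) →
      ∃ w : M.X (n + 1), z - M.d (n + 1) n w ∈ Set.range (g.f n)) :
    ∃ δ : ∀ n : ℕ, M.homology (n + 1) →+ K.homology n,
      (∀ n, Function.Exact (HomologicalComplex.homologyMap f n)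
        (HomologicalComplex.homologyMap g n)) ∧
      (∀ n, Function.Exact (HomologicalComplex.homologyMap g (n + 1)) (δ n)) ∧
      (∀ n, Function.Exact (δ n) (HomologicalComplex.homologyMap f n)) ∧
      Function.Surjective (HomologicalComplex.homologyMap g 0) := by
  have fg : f ≫ g = 0 := by
    ext n x
    exact (ex n).apply_apply_eq_zero x
  have : Mono f := by
    have (n : ℕ) : Mono (f.f n) := (ModuleCat.mono_iff_injective _).2 (inj n)
    exact HomologicalComplex.mono_of_mono_f f inferInstance
  -- The long exact sequence is that of `0 → K → L → cokernel f → 0`. By exactness at `L` the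
  -- induced map `r : cokernel f ⟶ M` is injective, and it has the same range as `g`, so `acyclic`
  -- makes it bijective in homology.
  let S : ShortComplex (ChainComplex (ModuleCat.{u} ℤ) ℕ) :=
    ShortComplex.mk f (cokernel.π f) (cokernel.condition f)
  have hS : S.ShortExact :=
    { exact := ShortComplex.exact_of_g_is_cokernel _ (cokernelIsCokernel f) }
  let q := cokernel.π f
  let r : cokernel f ⟶ M := cokernel.desc f g fg
  have hqr : q ≫ r = g := cokernel.π_desc _ _ _
  have hq : ∀ n, Function.Surjective (q.f n) := fun n =>
    (ModuleCat.epi_iff_surjective _).1 inferInstance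
  have hqr' : ∀ n x, r.f n (q.f n x) = g.f n x := fun n x => by
    rw [← hqr]; rfl
  have hrange : ∀ n, Set.range (r.f n) = Set.range (g.f n) := fun n => by
    rw [← hqr]
    exact ((hq n).range_comp (r.f n)).symm
  have hr : ∀ n, Function.Injective (r.f n) := by
    intro n
    rw [injective_iff_map_eq_zero]
    intro y hy
    obtain ⟨x, rfl⟩ := hq n y
    rw [hqr'] at hy
    obtain ⟨p, rfl⟩ := (ex n _).1 hy
    exact ConcreteCategory.congr_hom (HomologicalComplex.congr_hom (cokernel.condition f) n) p
  have hbij : ∀ n, Function.Bijective (HomologicalComplex.homologyMap r n) :=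
    homologyMap_bijective r hr (fun n z hz => by
      rw [hrange] at hz ⊢
      exact acyclic n z hz)
  have hmap : ∀ n x, HomologicalComplex.homologyMap g n x =
      HomologicalComplex.homologyMap r n (HomologicalComplex.homologyMap q n x) := by
    intro n x
    rw [← hqr, HomologicalComplex.homologyMap_comp]
    rfl
  let e : ∀ n, (cokernel f).homology n ≃+ M.homology n := fun n =>
    AddEquiv.ofBijective (HomologicalComplex.homologyMap r n).hom.toAddMonoidHom (hbij n)
  have hrel : ∀ n, (ComplexShape.down ℕ).Rel (n + 1) n := fun n => by simp
  refine ⟨fun n => (hS.δ (n + 1) n (hrel n)).hom.toAddMonoidHom.comp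
    (e (n + 1)).symm.toAddMonoidHom,
    ?_, ?_, ?_, ?_⟩
  · intro n y
    have := (ShortComplex.ShortExact.moduleCat_exact_iff_function_exact _).1
      (hS.homology_exact₂ n) y
    refine Iff.trans ?_ this
    rw [hmap]
    exact map_eq_zero_iff _ (hbij n).1
  · intro n y
    obtain ⟨y, rfl⟩ := (e (n + 1)).surjective y
    have := (ShortComplex.ShortExact.moduleCat_exact_iff_function_exact _).1
      (hS.homology_exact₃ (n + 1) n (hrel n)) y
    refine Iff.trans ?_ (this.trans ?_)
    · simp [S]
    · simp only [Set.mem_range, hmap]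
      exact exists_congr fun x => (e (n + 1)).injective.eq_iff.symm
  · intro n y
    have := (ShortComplex.ShortExact.moduleCat_exact_iff_function_exact _).1
      (hS.homology_exact₁ (n + 1) n (hrel n)) y
    refine this.trans ?_
    constructor
    · rintro ⟨x, rfl⟩
      exact ⟨e (n + 1) x, by simp [S]⟩
    · rintro ⟨x, rfl⟩
      exact ⟨_, rfl⟩
  · intro h
    obtain ⟨z, rfl⟩ := exists_homologyπ_eq 0 h
    obtain ⟨w, s, hs⟩ := acyclic 0 (M.iCycles 0 z) ⟨0, by rw [map_zero, d_iCycles]⟩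
    -- Every chain of degree `0` is a cycle.
    obtain ⟨y, hy⟩ := exists_cycle 0 s (by rw [L.shape _ _ (by simp)]; rfl)
    have hi : M.iCycles 0 (HomologicalComplex.cyclesMap g 0 y) = g.f 0 (L.iCycles 0 y) :=
      ConcreteCategory.congr_hom (HomologicalComplex.cyclesMap_i g 0) y
    have hπ : HomologicalComplex.homologyMap g 0 (L.homologyπ 0 y) =
        M.homologyπ 0 (HomologicalComplex.cyclesMap g 0 y) :=
      ConcreteCategory.congr_hom (HomologicalComplex.homologyπ_naturality g 0) y
    refine ⟨L.homologyπ 0 y, ?_⟩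
    rw [hπ, ← sub_eq_zero, ← map_sub, homologyπ_eq_zero_iff]
    refine ⟨-w, ?_⟩
    rw [map_sub, hi, hy, hs, map_neg]
    abel

/-- If an endomorphism `τ`, homotopic to the identity by a homotopy preserving a subcomplex `S`,
eventually moves every chain into `S`, then the quotient by `S` is acyclic. -/
theorem acyclic_of_subdivision (S : ∀ n, AddSubgroup (K.X n)) (τ : ∀ n, K.X n → K.X n)
    (D : ∀ n, K.X n → K.X (n + 1))
    (d_τ : ∀ n x, K.d (n + 1) n (τ (n + 1) x) = τ n (K.d (n + 1) n x))
    (homotopy_zero : ∀ x, K.d 1 0 (D 0 x) = x - τ 0 x)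
    (homotopy_succ : ∀ n x,
      K.d (n + 2) (n + 1) (D (n + 1) x) + D n (K.d (n + 1) n x) = x - τ (n + 1) x)
    (D_mem : ∀ n, ∀ x ∈ S n, D n x ∈ S (n + 1)) (τ_mem : ∀ n, ∀ x ∈ S n, τ n x ∈ S n)
    (eventually : ∀ n x, ∃ m, (τ n)^[m] x ∈ S n) (n : ℕ) (z : K.X n)
    (hz : K.d n (n - 1) z ∈ S (n - 1)) : ∃ w : K.X (n + 1), z - K.d (n + 1) n w ∈ S n := by
  obtain ⟨m, hm⟩ := eventually n z
  -- Induction on the number of subdivisions needed. Since `z - τ z = d D z + D d z` and `D d z` is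
  -- in `S`, a correction `w` for `τ z` yields the correction `D z + w` for `z`.
  induction m generalizing z with
  | zero => exact ⟨0, by simpa using hm⟩
  | succ m ih =>
    have hτ : K.d n (n - 1) (τ n z) ∈ S (n - 1) := by
      cases n with
      | zero =>
        rw [K.shape _ _ (by simp)]
        exact (S _).zero_mem
      | succ n =>
        change K.d (n + 1) n (τ (n + 1) z) ∈ S n
        rw [d_τ]
        exact τ_mem n _ hz
    obtain ⟨w, hw⟩ := ih (τ n z) hτ hm
    refine ⟨D n z + w, ?_⟩
    cases n with
    | zero =>
      rw [map_add, homotopy_zero, sub_add_eq_sub_sub, sub_sub_cancel]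
      exact hw
    | succ n =>
      have h := homotopy_succ n z
      have h' : z - K.d (n + 2) (n + 1) (D (n + 1) z + w) =
          (τ (n + 1) z - K.d (n + 2) (n + 1) w) + D n (K.d (n + 1) n z) := by
        rw [map_add, ← sub_eq_iff_eq_add.2 h.symm]
        abel
      change z - K.d (n + 2) (n + 1) (D (n + 1) z + w) ∈ S (n + 1)
      rw [h']
      exact (S _).add_mem hw (D_mem n _ hz)

end ChainComplex

/-! ### Reduction of Mayer–Vietoris to acyclicity modulo small chains. -/

section MayerVietoris

variable (C : Cl.{u} ⥤ ChainComplex (ModuleCat.{u} ℤ) ℕ) {X : Type u} [ClosureSpace X]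
  (A B : Set X)

/-- The chains of `X` that are sums of chains of `A` and of `B`. -/
def smallChains (n : ℕ) : AddSubgroup ((C.obj (Cl.of X)).X n) :=
  (((C.map (Cl.val A)).f n).hom.toAddMonoidHom.coprod
    ((C.map (Cl.val B)).f n).hom.toAddMonoidHom).range

variable {C A B} in
theorem mem_smallChains {n : ℕ} {c : (C.obj (Cl.of X)).X n} :
    c ∈ smallChains C A B n ↔ ∃ a b, (C.map (Cl.val A)).f n a + (C.map (Cl.val B)).f n b = c := by
  constructor
  · rintro ⟨⟨a, b⟩, rfl⟩
    exact ⟨a, b, rfl⟩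
  · rintro ⟨a, b, rfl⟩
    exact ⟨(a, b), rfl⟩

/-- The first two hypotheses give exactness of `0 → C(A ∩ B) → C(A) ⊞ C(B) → C(X)` at its first two
terms, and the third handles the cokernel of the last map, whose image is `smallChains`. The
resulting sequence is then transported from the homology of the biproduct to the product of the
homologies. -/
theorem hasMayerVietorisSequence_of_acyclic
    (inj : ∀ n, Function.Injective
      ((C.map (Cl.incl (Set.inter_subset_left : A ∩ B ⊆ A))).f n))
    (pullback : ∀ n a b, (C.map (Cl.val A)).f n a + (C.map (Cl.val B)).f n b = 0 →
      ∃ x, (C.map (Cl.incl (Set.inter_subset_left : A ∩ B ⊆ A))).f n x = a ∧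
        (C.map (Cl.incl (Set.inter_subset_right : A ∩ B ⊆ B))).f n x = -b)
    (acyclic : ∀ (n : ℕ) (z : (C.obj (Cl.of X)).X n),
      (C.obj (Cl.of X)).d n (n - 1) z ∈ smallChains C A B (n - 1) →
      ∃ w, z - (C.obj (Cl.of X)).d (n + 1) n w ∈ smallChains C A B n) :
    HasMayerVietorisSequence C A B := by
  let i := C.map (Cl.incl (Set.inter_subset_left : A ∩ B ⊆ A))
  let j := C.map (Cl.incl (Set.inter_subset_right : A ∩ B ⊆ B))
  let k := C.map (Cl.val A)
  let l := C.map (Cl.val B)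
  have hij : i ≫ k = j ≫ l := by
    simp only [i, j, k, l, ← C.map_comp]
    rfl
  let f := biprod.lift i (-j)
  let g := biprod.desc k l
  let b₁ : C.obj (Cl.of A) ⟶ C.obj (Cl.of A) ⊞ C.obj (Cl.of B) := biprod.inl
  let b₂ : C.obj (Cl.of B) ⟶ C.obj (Cl.of A) ⊞ C.obj (Cl.of B) := biprod.inr
  let p₁ : C.obj (Cl.of A) ⊞ C.obj (Cl.of B) ⟶ C.obj (Cl.of A) := biprod.fst
  let p₂ : C.obj (Cl.of A) ⊞ C.obj (Cl.of B) ⟶ C.obj (Cl.of B) := biprod.snd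
  have total : ∀ n x, b₁.f n (p₁.f n x) + b₂.f n (p₂.f n x) = x := fun n x =>
    ConcreteCategory.congr_hom (HomologicalComplex.congr_hom
      (biprod.total (X := C.obj (Cl.of A)) (Y := C.obj (Cl.of B))) n) x
  have hf : f = i ≫ b₁ - j ≫ b₂ := by
    apply biprod.hom_ext <;> simp [f, b₁, b₂]
  have hg : g = p₁ ≫ k + p₂ ≫ l := by
    apply biprod.hom_ext' <;> simp [g, p₁, p₂]
  have hf₁ : f ≫ p₁ = i := biprod.lift_fst _ _
  have hf' : ∀ n x, f.f n x = b₁.f n (i.f n x) - b₂.f n (j.f n x) := fun n x => by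
    rw [hf]; rfl
  have hg' : ∀ n x, g.f n x = k.f n (p₁.f n x) + l.f n (p₂.f n x) := fun n x => by
    rw [hg]; rfl
  have hrange : ∀ n, Set.range (g.f n) = smallChains C A B n := by
    intro n
    ext c
    rw [SetLike.mem_coe, mem_smallChains]
    constructor
    · rintro ⟨x, rfl⟩
      exact ⟨_, _, (hg' n x).symm⟩
    · rintro ⟨a, b, rfl⟩
      refine ⟨b₁.f n a + b₂.f n b, ?_⟩
      have h₁ : b₁ ≫ g = k := biprod.inl_desc _ _
      have h₂ : b₂ ≫ g = l := biprod.inr_desc _ _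
      rw [map_add]
      exact congrArg₂ (· + ·) (ConcreteCategory.congr_hom (HomologicalComplex.congr_hom h₁ n) a)
        (ConcreteCategory.congr_hom (HomologicalComplex.congr_hom h₂ n) b)
  obtain ⟨δ, h₁, h₂, h₃, h₄⟩ := ChainComplex.exists_long_exact_sequence f g
    (fun n x y h => inj n (by
      have h' : ∀ x, p₁.f n (f.f n x) = i.f n x := fun x =>
        ConcreteCategory.congr_hom (HomologicalComplex.congr_hom hf₁ n) x
      exact (h' x).symm.trans ((congrArg (p₁.f n) h).trans (h' y))))
    (fun n x => by
      constructor
      · intro h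
        rw [hg'] at h
        obtain ⟨y, h₁, h₂⟩ := pullback n _ _ h
        refine ⟨y, ?_⟩
        rw [hf']
        change b₁.f n ((C.map (Cl.incl _)).f n y) - b₂.f n ((C.map (Cl.incl _)).f n y) = x
        rw [h₁, h₂, map_neg, sub_neg_eq_add, total]
      · rintro ⟨y, rfl⟩
        have : f ≫ g = 0 := by simp [f, g, hij]
        exact ConcreteCategory.congr_hom (HomologicalComplex.congr_hom this n) y)
    (fun n z hz => by
      rw [hrange] at hz ⊢
      exact acyclic n z hz)
  -- Homology is additive, so the two projections of the biproduct induce a bijection onto the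
  -- product.
  let e : ∀ n, (C.obj (Cl.of A) ⊞ C.obj (Cl.of B)).homology n → Hlgy C n A × Hlgy C n B :=
    fun n x => (HomologicalComplex.homologyMap p₁ n x, HomologicalComplex.homologyMap p₂ n x)
  have hmap : ∀ {K L : ChainComplex (ModuleCat.{u} ℤ) ℕ} {u v : K ⟶ L} (n x), u = v →
      HomologicalComplex.homologyMap u n x = HomologicalComplex.homologyMap v n x := by
    rintro _ _ _ _ _ _ rfl; rfl
  have e_inj : ∀ n, Function.Injective (e n) := by
    intro n x y h
    have key : ∀ x, HomologicalComplex.homologyMap b₁ n (e n x).1 +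
        HomologicalComplex.homologyMap b₂ n (e n x).2 = x := by
      intro x
      have := hmap n x (biprod.total (X := C.obj (Cl.of A)) (Y := C.obj (Cl.of B)))
      rw [HomologicalComplex.homologyMap_add, HomologicalComplex.homologyMap_comp,
        HomologicalComplex.homologyMap_comp, HomologicalComplex.homologyMap_id] at this
      exact this
    rw [← key x, ← key y, h]
  have e_surj : ∀ n, Function.Surjective (e n) := by
    rintro n ⟨a, b⟩
    refine ⟨HomologicalComplex.homologyMap b₁ n a + HomologicalComplex.homologyMap b₂ n b, ?_⟩
    have h11 := hmap n a (biprod.inl_fst (X := C.obj (Cl.of A)) (Y := C.obj (Cl.of B)))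
    have h12 := hmap n a (biprod.inl_snd (X := C.obj (Cl.of A)) (Y := C.obj (Cl.of B)))
    have h21 := hmap n b (biprod.inr_fst (X := C.obj (Cl.of A)) (Y := C.obj (Cl.of B)))
    have h22 := hmap n b (biprod.inr_snd (X := C.obj (Cl.of A)) (Y := C.obj (Cl.of B)))
    simp only [HomologicalComplex.homologyMap_comp, HomologicalComplex.homologyMap_id,
      HomologicalComplex.homologyMap_zero] at h11 h12 h21 h22
    apply Prod.ext
    · simp only [e, map_add]
      refine (congrArg₂ (· + ·) h11 h21).trans ?_
      simp
    · simp only [e, map_add]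
      refine (congrArg₂ (· + ·) h12 h22).trans ?_
      simp
  have ef : ∀ n x, mvDiff C A B n x = e n (HomologicalComplex.homologyMap f n x) := by
    intro n x
    have h₁ := hmap n x hf₁
    have h₂ := hmap n x (biprod.lift_snd i (-j))
    rw [HomologicalComplex.homologyMap_comp] at h₁ h₂
    rw [HomologicalComplex.homologyMap_neg] at h₂
    exact Prod.ext h₁.symm h₂.symm
  have eg : ∀ n x, mvSum C A B n (e n x) = HomologicalComplex.homologyMap g n x := by
    intro n x
    have h := hmap n x hg
    rw [HomologicalComplex.homologyMap_add, HomologicalComplex.homologyMap_comp,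
      HomologicalComplex.homologyMap_comp] at h
    exact h.symm
  refine ⟨δ, ?_, ?_, ?_, ?_⟩
  · intro n y
    obtain ⟨y, rfl⟩ := e_surj n y
    rw [eg, h₁ n y]
    simp only [Set.mem_range, ef, (e_inj n).eq_iff]
  · intro n y
    rw [h₂ n y]
    simp only [Set.mem_range, (e_surj (n + 1)).exists, eg]
  · intro n y
    rw [← h₃ n y, ef]
    constructor
    · intro h
      apply e_inj n
      rw [h]
      simp only [e, map_zero]
      rfl
    · intro h
      rw [h]
      simp [e]
  · intro y
    obtain ⟨x, hx⟩ := h₄ y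
    exact ⟨e 0 x, by rw [eg, hx]⟩

end MayerVietoris

/-! ### Free abelian groups on continuous maps, and small maps. -/

theorem Finsupp.exists_mapDomain_of_mapDomain_add_eq_zero {P S T Z : Type*} {p : P → S} {q : P → T}
    {f : S → Z} {g : T → Z} (hf : Function.Injective f) (hg : Function.Injective g)
    (comm : ∀ x, f (p x) = g (q x)) (hp : Function.Injective p)
    (lift : ∀ s t, f s = g t → ∃ x, p x = s)
    {a : S →₀ ℤ} {b : T →₀ ℤ} (h : a.mapDomain f + b.mapDomain g = 0) :
    ∃ x : P →₀ ℤ, x.mapDomain p = a ∧ x.mapDomain q = -b := by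
  classical
  -- As `f` is injective, `f s` has coefficient `a s` in the first sum. The second sum must cancel
  -- it, so `f s` is also a value of `g`, and `s` lifts to `P`.
  have hsupp : ∀ s, a s ≠ 0 → ∃ x, p x = s := by
    intro s hs
    have h1 := DFunLike.congr_fun h (f s)
    rw [Finsupp.add_apply, Finsupp.mapDomain_apply hf, Finsupp.zero_apply] at h1
    by_contra hx
    have h2 : b.mapDomain g (f s) = 0 :=
      Finsupp.mapDomain_of_notMem_range _ _ (by rintro ⟨t, ht⟩; exact hx (lift s t ht.symm))
    rw [h2, add_zero] at h1
    exact hs h1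
  refine ⟨a.comapDomain p hp.injOn, ?_⟩
  have ha : (a.comapDomain p hp.injOn).mapDomain p = a :=
    Finsupp.mapDomain_comapDomain p hp a (fun s hs => hsupp s (by simpa using hs))
  refine ⟨ha, Finsupp.mapDomain_injective hg ?_⟩
  rw [← Finsupp.mapDomain_comp, show g ∘ q = f ∘ p from (funext comm).symm,
    Finsupp.mapDomain_comp, ha]
  have hneg : (-b).mapDomain g = -(b.mapDomain g) := (Finsupp.lmapDomain ℤ ℤ g).map_neg b
  rw [hneg]
  exact eq_neg_of_add_eq_zero_left h

namespace CMap

variable {Z : Type w} {X : Type u} [ClosureSpace Z] [ClosureSpace X]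

theorem comp_val_injective (A : Set X) :
    Function.Injective (fun σ : CMap Z A => CMap.comp (Cl.val A) σ) := by
  intro σ τ h
  apply CMap.ext
  funext z
  exact Subtype.ext (congrFun (congrArg CMap.toFun h) z)

theorem comp_incl_injective {A B : Set X} (hAB : A ⊆ B) :
    Function.Injective (fun σ : CMap Z A => CMap.comp (Cl.incl hAB) σ) := by
  intro σ τ h
  apply CMap.ext
  funext z
  have h' := congrArg (fun y : B => (y : X)) (congrFun (congrArg CMap.toFun h) z)
  exact Subtype.ext h'

/-- A continuous map with values in a subspace, as a map to that subspace. -/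
def codRestrict (σ : CMap Z X) (A : Set X) (h : ∀ z, σ.toFun z ∈ A) : CMap Z A where
  toFun z := ⟨σ.toFun z, h z⟩
  cont := by
    rintro S _ ⟨z, hz, rfl⟩
    change σ.toFun z ∈ cl (Subtype.val '' _)
    rw [← Set.image_comp]
    exact σ.cont S ⟨z, hz, rfl⟩

/-- The set of maps `Z → X` with image in `A` or in `B`. -/
def small (Z : Type w) [ClosureSpace Z] (A B : Set X) : Set (CMap Z X) :=
  {σ | (∀ z, σ.toFun z ∈ A) ∨ ∀ z, σ.toFun z ∈ B}

/-- Each generator factors through `A` or through `B`. With `mapDomain_add_mem_supported_small` this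
turns smallness of a chain into a condition on its support, which can be checked one generator at a
time. -/
theorem exists_of_mem_supported_small {A B : Set X} {c : CMap Z X →₀ ℤ}
    (hc : c ∈ Finsupp.supported ℤ ℤ (small Z A B)) :
    ∃ (a : CMap Z A →₀ ℤ) (b : CMap Z B →₀ ℤ),
      a.mapDomain (fun σ => CMap.comp (Cl.val A) σ) +
        b.mapDomain (fun σ => CMap.comp (Cl.val B) σ) = c := by
  rw [Finsupp.supported_eq_span_single] at hc
  induction hc using Submodule.span_induction with
  | mem x hx =>
    obtain ⟨σ, hσ | hσ, rfl⟩ := hx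
    · exact ⟨Finsupp.single (σ.codRestrict A hσ) 1, 0, by
        rw [Finsupp.mapDomain_single, Finsupp.mapDomain_zero, add_zero]; rfl⟩
    · exact ⟨0, Finsupp.single (σ.codRestrict B hσ) 1, by
        rw [Finsupp.mapDomain_single, Finsupp.mapDomain_zero, zero_add]; rfl⟩
  | zero => exact ⟨0, 0, by simp⟩
  | add x y _ _ hx hy =>
    obtain ⟨a, b, rfl⟩ := hx
    obtain ⟨a', b', rfl⟩ := hy
    exact ⟨a + a', b + b', by rw [Finsupp.mapDomain_add, Finsupp.mapDomain_add]; abel⟩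
  | smul r x _ hx =>
    obtain ⟨a, b, rfl⟩ := hx
    exact ⟨r • a, r • b, by rw [Finsupp.mapDomain_smul, Finsupp.mapDomain_smul, smul_add]⟩

theorem mapDomain_add_mem_supported_small {A B : Set X} (a : CMap Z A →₀ ℤ) (b : CMap Z B →₀ ℤ) :
    a.mapDomain (fun σ => CMap.comp (Cl.val A) σ) + b.mapDomain (fun σ => CMap.comp (Cl.val B) σ) ∈
      Finsupp.supported ℤ ℤ (small Z A B) := by
  refine Submodule.add_mem _ ?_ ?_
  · refine Finsupp.supported_mono ?_ ((Finsupp.lmapDomain_supported ℤ ℤ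
      (fun σ : CMap Z A => CMap.comp (Cl.val A) σ) Set.univ).le
        ⟨a, Finsupp.supported_univ.ge trivial, rfl⟩)
    rintro _ ⟨σ, -, rfl⟩
    exact Or.inl fun z => (σ.toFun z).2
  · refine Finsupp.supported_mono ?_ ((Finsupp.lmapDomain_supported ℤ ℤ
      (fun σ : CMap Z B => CMap.comp (Cl.val B) σ) Set.univ).le
        ⟨b, Finsupp.supported_univ.ge trivial, rfl⟩)
    rintro _ ⟨σ, -, rfl⟩
    exact Or.inr fun z => (σ.toFun z).2

/-- A map into `A` and a map into `B` that agree in `X` both land in `A ∩ B`, and the common map is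
continuous into the subspace; only such maps can cancel. -/
theorem exists_of_mapDomain_add_eq_zero {A B : Set X} {a : CMap Z A →₀ ℤ} {b : CMap Z B →₀ ℤ}
    (h : a.mapDomain (fun σ => CMap.comp (Cl.val A) σ) +
      b.mapDomain (fun σ => CMap.comp (Cl.val B) σ) = 0) :
    ∃ x : CMap Z (A ∩ B : Set X) →₀ ℤ,
      x.mapDomain (fun σ => CMap.comp (Cl.incl Set.inter_subset_left) σ) = a ∧
      x.mapDomain (fun σ => CMap.comp (Cl.incl Set.inter_subset_right) σ) = -b := by
  refine Finsupp.exists_mapDomain_of_mapDomain_add_eq_zero (comp_val_injective A)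
    (comp_val_injective B) (fun _ => rfl) (comp_incl_injective _) ?_ h
  intro σ τ hστ
  have hB : ∀ z, ((CMap.comp (Cl.val A) σ).toFun z) ∈ B := fun z => by
    rw [hστ]
    exact (τ.toFun z).2
  exact ⟨CMap.codRestrict (CMap.comp (Cl.val A) σ) (A ∩ B) fun z => ⟨(σ.toFun z).2, hB z⟩, rfl⟩

end CMap

theorem ClosureSpace.IsInteriorCover.mem_or_mem {X : Type u} [ClosureSpace X] {A B : Set X}
    (h : IsInteriorCover ({A, B} : Set (Set X))) (x : X) : x ∈ int A ∨ x ∈ int B := by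
  have hx : x ∈ ⋃ U ∈ ({A, B} : Set (Set X)), int U := by
    rw [show (⋃ U ∈ ({A, B} : Set (Set X)), int U) = Set.univ from h]
    trivial
  simpa using hx

/-- If some point of `Z` is in the closure of every other one, then every map from `Z` is small
with respect to every interior cover. -/
theorem CMap.mem_small_of_forall_mem_cl {Z : Type w} {X : Type u} [ClosureSpace Z] [ClosureSpace X]
    {A B : Set X} (hAB : IsInteriorCover ({A, B} : Set (Set X))) (p : Z)
    (hp : ∀ z, p ∈ cl ({z} : Set Z)) (σ : CMap Z X) : σ ∈ CMap.small Z A B := by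
  -- Continuity puts `σ p` in the closure of `{σ z}`, so every neighbourhood of `σ p` contains `σ
  -- z`.
  have key : ∀ U : Set X, σ.toFun p ∈ int U → ∀ z, σ.toFun z ∈ U := by
    intro U hU z
    obtain ⟨_, ⟨_, rfl, rfl⟩, hy⟩ := mem_cl_iff.1 (σ.cont {z} ⟨p, hp z, rfl⟩) U hU
    exact hy
  exact (hAB.mem_or_mem (σ.toFun p)).imp (key A) (key B)

/-! ### Chains of tuples -/

/-- The free abelian group on the `m`-tuples of elements of `α`. -/
abbrev TupleChain (α : Type v) (m : ℕ) : Type v := (Fin m → α) →₀ ℤ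

namespace TupleChain

variable {α : Type v} {β : Type w}

/-- The alternating sum of the omissions of one entry. -/
noncomputable def bdry (α : Type v) (m : ℕ) : TupleChain α (m + 1) →ₗ[ℤ] TupleChain α m :=
  ∑ k : Fin (m + 1), (-1 : ℤ) ^ (k : ℕ) • Finsupp.lmapDomain ℤ ℤ (fun v => v ∘ k.succAbove)

theorem bdry_single (m : ℕ) (v : Fin (m + 1) → α) : bdry α m (Finsupp.single v 1) =
    ∑ k : Fin (m + 1), (-1 : ℤ) ^ (k : ℕ) • Finsupp.single (v ∘ k.succAbove) 1 := by
  simp only [bdry, LinearMap.sum_apply, LinearMap.smul_apply, Finsupp.lmapDomain_apply,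
    Finsupp.mapDomain_single]

/-- The cone with apex `b`. -/
noncomputable def cone (b : α) (m : ℕ) : TupleChain α m →ₗ[ℤ] TupleChain α (m + 1) :=
  Finsupp.lmapDomain ℤ ℤ (fun v => Fin.cons b v)

theorem cone_single (b : α) (m : ℕ) (v : Fin m → α) :
    cone b m (Finsupp.single v 1) = Finsupp.single (Fin.cons b v : Fin (m + 1) → α) 1 :=
  Finsupp.mapDomain_single

/-- The grading counts entries, so a singular `m`-simplex corresponds to `m + 1` entries and the
empty tuple augments the complex. At the augmentation the cone formula has no correction term. -/
theorem bdry_cone_zero (b : α) (x : TupleChain α 0) : bdry α 0 (cone b 0 x) = x := by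
  induction x using Finsupp.induction_linear with
  | zero => simp
  | add x y hx hy => rw [map_add, map_add, hx, hy]
  | single v r =>
    rw [← mul_one r, ← smul_eq_mul, ← Finsupp.smul_single, map_smul, map_smul, cone_single,
      bdry_single]
    rw [Fin.sum_univ_one, Fin.val_zero, pow_zero, one_smul]
    congr 2

/-- Omitting the apex returns the tuple; omitting a later entry gives a cone on a face, with the
sign changed because the index shifts by one. -/
theorem bdry_cone (b : α) (m : ℕ) (x : TupleChain α (m + 1)) :
    bdry α (m + 1) (cone b (m + 1) x) = x - cone b m (bdry α m x) := by
  induction x using Finsupp.induction_linear with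
  | zero => simp
  | add x y hx hy => simp only [map_add, hx, hy]; abel
  | single v r =>
    rw [← mul_one r, ← smul_eq_mul, ← Finsupp.smul_single]
    simp only [map_smul, cone_single, bdry_single, ← smul_sub, map_sum]
    congr 1
    rw [Fin.sum_univ_succ, sub_eq_add_neg, ← Finset.sum_neg_distrib]
    refine congrArg₂ (· + ·) ?_ (Finset.sum_congr rfl fun k _ => ?_)
    · rw [Fin.val_zero, pow_zero, one_smul]
      congr 1
    · rw [Fin.val_succ, pow_succ, mul_neg_one, neg_smul]
      congr 3
      funext j
      refine Fin.cases ?_ (fun j => ?_) j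
      · simp
      · simp [Fin.succ_succAbove_succ]

/-- Every tuple is the cone on its tail with its first entry as apex, so the cone formula gives the
claim by induction. -/
theorem bdry_bdry (m : ℕ) (x : TupleChain α (m + 2)) : bdry α m (bdry α (m + 1) x) = 0 := by
  induction m with
  | zero =>
    induction x using Finsupp.induction_linear with
    | zero => simp
    | add x y hx hy => simp only [map_add, hx, hy, add_zero]
    | single v r =>
      rw [← mul_one r, ← smul_eq_mul, ← Finsupp.smul_single, ← Fin.cons_self_tail v,
        ← cone_single, map_smul, map_smul, bdry_cone, map_sub, bdry_cone_zero, sub_self, smul_zero]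
  | succ m ih =>
    induction x using Finsupp.induction_linear with
    | zero => simp
    | add x y hx hy => simp only [map_add, hx, hy, add_zero]
    | single v r =>
      rw [← mul_one r, ← smul_eq_mul, ← Finsupp.smul_single, ← Fin.cons_self_tail v,
        ← cone_single, map_smul, map_smul, bdry_cone, map_sub, bdry_cone, ih, map_zero, sub_zero,
        sub_self, smul_zero]

/-- The map of tuple chains induced by a map of entries. -/
noncomputable def map (f : α → β) (m : ℕ) : TupleChain α m →ₗ[ℤ] TupleChain β m :=
  Finsupp.lmapDomain ℤ ℤ (fun v => f ∘ v)

theorem map_single (f : α → β) (m : ℕ) (v : Fin m → α) :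
    map f m (Finsupp.single v 1) = Finsupp.single (f ∘ v) 1 :=
  Finsupp.mapDomain_single

theorem map_bdry (f : α → β) (m : ℕ) (x : TupleChain α (m + 1)) :
    map f m (bdry α m x) = bdry β m (map f (m + 1) x) := by
  simp only [map, bdry, LinearMap.sum_apply, LinearMap.smul_apply, map_sum, map_smul,
    Finsupp.lmapDomain_apply, ← Finsupp.mapDomain_comp]
  rfl

theorem map_cone (f : α → β) (b : α) (m : ℕ) (x : TupleChain α m) :
    map f (m + 1) (cone b m x) = cone (f b) m (map f m x) := by
  simp only [map, cone, Finsupp.lmapDomain_apply, ← Finsupp.mapDomain_comp]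
  congr 1
  funext v j
  refine Fin.cases ?_ (fun j => ?_) j <;> simp

variable (bary : ∀ m, (Fin (m + 1) → α) → α) (bary' : ∀ m, (Fin (m + 1) → β) → β)

/-- The subdivision of tuple chains with respect to a choice of barycenters. -/
noncomputable def subdiv : ∀ m, TupleChain α m →ₗ[ℤ] TupleChain α m
  | 0 => LinearMap.id
  | m + 1 => Finsupp.linearCombination ℤ fun v =>
      cone (bary m v) m (subdiv m (bdry α m (Finsupp.single v 1)))

/-- The homotopy from the subdivision to the identity. -/
noncomputable def homotopy : ∀ m, TupleChain α m →ₗ[ℤ] TupleChain α (m + 1)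
  | 0 => 0
  | m + 1 => Finsupp.linearCombination ℤ fun v =>
      cone (bary m v) (m + 1) (Finsupp.single v 1 - subdiv bary (m + 1) (Finsupp.single v 1) -
        homotopy m (bdry α m (Finsupp.single v 1)))

theorem subdiv_single (m : ℕ) (v : Fin (m + 1) → α) :
    subdiv bary (m + 1) (Finsupp.single v 1) =
      cone (bary m v) m (subdiv bary m (bdry α m (Finsupp.single v 1))) := by
  simp [subdiv, Finsupp.linearCombination_single]

theorem homotopy_single (m : ℕ) (v : Fin (m + 1) → α) :
    homotopy bary (m + 1) (Finsupp.single v 1) =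
      cone (bary m v) (m + 1) (Finsupp.single v 1 - subdiv bary (m + 1) (Finsupp.single v 1) -
        homotopy bary m (bdry α m (Finsupp.single v 1))) := by
  simp [homotopy, Finsupp.linearCombination_single]

theorem _root_.Finsupp.linearMap_apply_eq_of_single {M : Type*} [AddCommGroup M] {S : Type*}
    {f g : (S →₀ ℤ) →ₗ[ℤ] M}
    (h : ∀ s, f (Finsupp.single s 1) = g (Finsupp.single s 1)) (x : S →₀ ℤ) : f x = g x := by
  have : f = g := by
    apply Finsupp.lhom_ext'
    intro s
    apply LinearMap.ext_ring
    exact h s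
  rw [this]

/-- The subdivision of `v` is the cone on the subdivision of `∂v`. By induction the correction term
of the cone formula is a cone on the subdivision of `∂∂v = 0`. -/
theorem bdry_subdiv (m : ℕ) (x : TupleChain α (m + 1)) :
    bdry α m (subdiv bary (m + 1) x) = subdiv bary m (bdry α m x) := by
  induction m with
  | zero =>
    refine Finsupp.linearMap_apply_eq_of_single (f := bdry α 0 ∘ₗ subdiv bary 1)
      (g := subdiv bary 0 ∘ₗ bdry α 0)
      (fun v => ?_) x
    simp only [LinearMap.comp_apply]
    rw [subdiv_single, bdry_cone_zero]
  | succ m ih =>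
    refine Finsupp.linearMap_apply_eq_of_single (f := bdry α (m + 1) ∘ₗ subdiv bary (m + 2))
      (g := subdiv bary (m + 1) ∘ₗ bdry α (m + 1)) (fun v => ?_) x
    simp only [LinearMap.comp_apply]
    rw [subdiv_single, bdry_cone, ih, bdry_bdry, map_zero, map_zero, sub_zero]

/-- With `D` the homotopy, `D v` is the cone on `v - sd v - D ∂v`, and a cone bounds its base when
the base is a cycle. The base is one by the formula in the preceding degree applied to `∂v`. -/
theorem bdry_homotopy (m : ℕ) (x : TupleChain α (m + 1)) :
    bdry α (m + 1) (homotopy bary (m + 1) x) + homotopy bary m (bdry α m x) =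
      x - subdiv bary (m + 1) x := by
  have key : ∀ (m : ℕ), (∀ v : Fin (m + 1) → α, bdry α m (homotopy bary m
      (bdry α m (Finsupp.single v 1))) = bdry α m (Finsupp.single v 1) -
        subdiv bary m (bdry α m (Finsupp.single v 1))) → ∀ x : TupleChain α (m + 1),
      bdry α (m + 1) (homotopy bary (m + 1) x) + homotopy bary m (bdry α m x) =
        x - subdiv bary (m + 1) x := by
    intro m h x
    refine Finsupp.linearMap_apply_eq_of_single
      (f := bdry α (m + 1) ∘ₗ homotopy bary (m + 1) + homotopy bary m ∘ₗ bdry α m)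
      (g := LinearMap.id - subdiv bary (m + 1)) (fun v => ?_) x
    simp only [LinearMap.comp_apply, LinearMap.add_apply, LinearMap.sub_apply, LinearMap.id_apply]
    rw [homotopy_single, bdry_cone]
    simp only [map_sub]
    rw [h, bdry_subdiv, map_sub]
    abel
  induction m with
  | zero =>
    refine key 0 (fun v => ?_) x
    simp [homotopy, subdiv]
  | succ m ih =>
    refine key (m + 1) (fun v => ?_) x
    have := ih (bdry α (m + 1) (Finsupp.single v 1))
    rwa [bdry_bdry, map_zero, add_zero] at this

variable {bary bary'}

/-- Naturality under maps that preserve barycenters. It lets the operators on singular chains be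
defined from the vertices of the standard simplex alone. -/
theorem map_subdiv {f : α → β} (hf : ∀ m v, f (bary m v) = bary' m (f ∘ v)) (m : ℕ)
    (x : TupleChain α m) : map f m (subdiv bary m x) = subdiv bary' m (map f m x) := by
  induction m with
  | zero => rfl
  | succ m ih =>
    refine Finsupp.linearMap_apply_eq_of_single (f := map f (m + 1) ∘ₗ subdiv bary (m + 1))
      (g := subdiv bary' (m + 1) ∘ₗ map f (m + 1)) (fun v => ?_) x
    simp only [LinearMap.comp_apply]
    rw [subdiv_single, map_single, subdiv_single, map_cone, ih, map_bdry, map_single, hf]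

theorem map_homotopy {f : α → β} (hf : ∀ m v, f (bary m v) = bary' m (f ∘ v)) (m : ℕ)
    (x : TupleChain α m) :
    map f (m + 1) (homotopy bary m x) = homotopy bary' m (map f m x) := by
  induction m with
  | zero => simp [homotopy]
  | succ m ih =>
    refine Finsupp.linearMap_apply_eq_of_single (f := map f (m + 2) ∘ₗ homotopy bary (m + 1))
      (g := homotopy bary' (m + 1) ∘ₗ map f (m + 1)) (fun v => ?_) x
    simp only [LinearMap.comp_apply]
    rw [homotopy_single, map_single, homotopy_single, map_cone, hf]
    simp only [map_sub]
    rw [ih, map_bdry, map_single, map_subdiv hf, map_single]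

end TupleChain

/-! ### Barycentric subdivision of topological simplices -/

namespace stdSimplex

variable {ι κ μ : Type*} [Fintype ι] [Fintype κ] [Fintype μ]

/-- The affine map of simplices with given values at the vertices. -/
noncomputable def affine (v : κ → stdSimplex ℝ ι) (t : stdSimplex ℝ κ) : stdSimplex ℝ ι :=
  ⟨fun i => ∑ j, t j * v j i,
    fun i => Finset.sum_nonneg fun j _ => mul_nonneg (zero_le t j) (zero_le (v j) i), by
      rw [Finset.sum_comm]
      simp [← Finset.mul_sum]⟩

theorem affine_apply (v : κ → stdSimplex ℝ ι) (t : stdSimplex ℝ κ) (i : ι) :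
    affine v t i = ∑ j, t j * v j i := rfl

theorem affine_affine (v : κ → stdSimplex ℝ ι) (w : μ → stdSimplex ℝ κ) (t : stdSimplex ℝ μ) :
    affine v (affine w t) = affine (affine v ∘ w) t := by
  ext i
  simp only [affine_apply, Function.comp, Finset.sum_mul, Finset.mul_sum, mul_assoc]
  exact Finset.sum_comm

theorem affine_vertices [DecidableEq κ] (t : stdSimplex ℝ κ) : affine vertex t = t := by
  ext i
  simp [affine_apply, Pi.single_apply]

theorem affine_vertex [DecidableEq κ] (v : κ → stdSimplex ℝ ι) (j : κ) :
    affine v (vertex j) = v j := by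
  ext i
  simp [affine_apply, Pi.single_apply]

theorem map_eq_affine [DecidableEq ι] (f : κ → ι) (t : stdSimplex ℝ κ) :
    map f t = affine (vertex ∘ f) t := by
  ext i
  rw [map_coe, FunOnFinite.linearMap_apply_apply, affine_apply]
  simp [Pi.single_apply, Finset.sum_filter, eq_comm]

theorem continuous_affine (v : κ → stdSimplex ℝ ι) : Continuous (affine v) := by
  refine Continuous.subtype_mk (continuous_pi fun i => ?_) _
  exact continuous_finsetSum _ fun j _ =>
    ((continuous_apply j).comp continuous_subtype_val).mul continuous_const

/-- The metric is the sup metric, and the weights sum to `1`, so `q` is the average of copies of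
itself; the bound follows in each coordinate from the triangle inequality. -/
theorem dist_affine_le (v : κ → stdSimplex ℝ ι) (t : stdSimplex ℝ κ) (q : stdSimplex ℝ ι) :
    dist q (affine v t) ≤ ∑ j, t j * dist q (v j) := by
  have h0 : 0 ≤ ∑ j, t j * dist q (v j) :=
    Finset.sum_nonneg fun j _ => mul_nonneg (zero_le t j) dist_nonneg
  rw [Subtype.dist_eq, dist_pi_le_iff h0]
  intro i
  have hq : q.1 i = ∑ j, t j * q i := by
    rw [← Finset.sum_mul, sum_eq_one, one_mul]
    rfl
  change |q.1 i - ∑ j, t j * v j i| ≤ _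
  rw [hq, ← Finset.sum_sub_distrib]
  refine (Finset.abs_sum_le_sum_abs _ _).trans (Finset.sum_le_sum fun j _ => ?_)
  rw [← mul_sub, abs_mul, abs_of_nonneg (zero_le t j)]
  exact mul_le_mul_of_nonneg_left (dist_le_pi_dist q.1 (v j).1 i) (zero_le t j)

theorem dist_affine_le_of_forall {v : κ → stdSimplex ℝ ι} {q : stdSimplex ℝ ι} {R : ℝ}
    (h : ∀ j, dist q (v j) ≤ R) (t : stdSimplex ℝ κ) : dist q (affine v t) ≤ R := by
  refine (dist_affine_le v t q).trans ?_
  calc ∑ j, t j * dist q (v j) ≤ ∑ j, t j * R :=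
        Finset.sum_le_sum fun j _ => mul_le_mul_of_nonneg_left (h j) (zero_le t j)
    _ = R := by rw [← Finset.sum_mul, sum_eq_one, one_mul]

/-- The barycenter of a tuple of points. -/
noncomputable def bary (m : ℕ) (v : Fin (m + 1) → stdSimplex ℝ ι) : stdSimplex ℝ ι :=
  affine v barycenter

theorem affine_bary (v : κ → stdSimplex ℝ ι) (m : ℕ) (w : Fin (m + 1) → stdSimplex ℝ κ) :
    affine v (bary m w) = bary m (affine v ∘ w) :=
  affine_affine v w _

/-- One of the `m + 1` distances being averaged is that of `v k` from itself, which gives the factor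
`m / (m + 1)`. -/
theorem dist_bary_le {m : ℕ} {v : Fin (m + 1) → stdSimplex ℝ ι} {r : ℝ}
    (h : ∀ i j, dist (v i) (v j) ≤ r) (k : Fin (m + 1)) :
    dist (bary m v) (v k) ≤ (1 - 1 / ((m + 1 : ℕ) : ℝ)) * r := by
  rw [dist_comm]
  refine (dist_affine_le v _ _).trans ?_
  have hb : ∀ j, (barycenter : stdSimplex ℝ (Fin (m + 1))) j = ((m + 1 : ℕ) : ℝ)⁻¹ := by
    intro j
    exact (barycenter_apply j).trans (by rw [Fintype.card_fin])
  simp only [hb]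
  rw [← Finset.mul_sum, Fin.sum_univ_succAbove _ k, dist_self, zero_add]
  have hs : ∑ j : Fin m, dist (v k) (v (k.succAbove j)) ≤ m * r := by
    refine (Finset.sum_le_sum fun j _ => h k (k.succAbove j)).trans ?_
    simp
  have hm : (0 : ℝ) < ((m + 1 : ℕ) : ℝ) := by positivity
  calc ((m + 1 : ℕ) : ℝ)⁻¹ * ∑ j : Fin m, dist (v k) (v (k.succAbove j))
      ≤ ((m + 1 : ℕ) : ℝ)⁻¹ * (m * r) := mul_le_mul_of_nonneg_left hs (inv_nonneg.2 hm.le)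
    _ = _ := by push_cast at hm ⊢; field_simp; ring

/-- Tuples in the convex hull of `v` whose diameter is smaller than that of `v` by the factor of
barycentric subdivision. -/
def fineTuples {m : ℕ} (v : Fin m → stdSimplex ℝ ι) : Set (Fin m → stdSimplex ℝ ι) :=
  {w | (∀ i q R, (∀ j, dist q (v j) ≤ R) → dist q (w i) ≤ R) ∧
    ∀ r, (∀ i j, dist (v i) (v j) ≤ r) → ∀ i j, dist (w i) (w j) ≤ (1 - 1 / (m : ℝ)) * r}

/-- In `fineTuples` the convex hull enters only through closed balls: a ball containing `v` contains
`w`. The ball about the barycenter from `dist_bary_le` controls the distances to the new vertex. The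
other distances satisfy the bound of the face, whose factor is smaller. -/
theorem cons_mem_fineTuples {m : ℕ} {v : Fin (m + 1) → stdSimplex ℝ ι} {k : Fin (m + 1)}
    {w : Fin m → stdSimplex ℝ ι} (hw : w ∈ fineTuples (v ∘ k.succAbove)) :
    (Fin.cons (bary m v) w : Fin (m + 1) → stdSimplex ℝ ι) ∈ fineTuples v := by
  obtain ⟨h₁, h₂⟩ := hw
  have h₁' : ∀ i q R, (∀ j, dist q (v j) ≤ R) → dist q (w i) ≤ R :=
    fun i q R h => h₁ i q R fun j => h _
  refine ⟨fun i q R h => ?_, fun r h i j => ?_⟩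
  · refine Fin.cases ?_ (fun i => ?_) i
    · exact dist_affine_le_of_forall h _
    · exact h₁' i q R h
  · have hr : 0 ≤ r := dist_nonneg.trans (h 0 0)
    have h0 : ∀ j, dist (bary m v) (w j) ≤ (1 - 1 / ((m + 1 : ℕ) : ℝ)) * r :=
      fun j => h₁' j _ _ fun k => dist_bary_le h k
    have hpos : 0 ≤ (1 - 1 / ((m + 1 : ℕ) : ℝ)) * r := dist_nonneg.trans (dist_bary_le h 0)
    refine Fin.cases ?_ (fun i => ?_) i <;> refine Fin.cases ?_ (fun j => ?_) j
    · simpa using hpos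
    · simpa using h0 j
    · simpa [dist_comm] using h0 i
    -- An index in `Fin m` exists, so `m ≠ 0` and `1 / m` is not the default value of division by
    -- zero.
    · have hm : (0 : ℝ) < m := Nat.cast_pos.2 (Fin.pos i)
      simp only [Fin.cons_succ]
      refine (h₂ r (fun i j => h _ _) i j).trans (mul_le_mul_of_nonneg_right ?_ hr)
      apply sub_le_sub_left
      apply one_div_le_one_div_of_le hm
      push_cast
      linarith

theorem subdiv_single_mem (m : ℕ) (v : Fin m → stdSimplex ℝ ι) :
    TupleChain.subdiv bary m (Finsupp.single v 1) ∈ Finsupp.supported ℤ ℤ (fineTuples v) := by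
  induction m with
  | zero =>
    refine Finsupp.single_mem_supported ℤ 1 ⟨fun i => i.elim0, fun r _ i => i.elim0⟩
  | succ m ih =>
    have hcone : ∀ (k : Fin (m + 1)) (x : TupleChain (stdSimplex ℝ ι) m),
        x ∈ Finsupp.supported ℤ ℤ (fineTuples (v ∘ k.succAbove)) →
        TupleChain.cone (bary m v) m x ∈ Finsupp.supported ℤ ℤ (fineTuples v) := by
      intro k x hx
      refine Finsupp.supported_mono (?_ : (fun w => Fin.cons (bary m v) w) ''
        fineTuples (v ∘ k.succAbove) ⊆ _) ?_
      · rintro _ ⟨w, hw, rfl⟩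
        exact cons_mem_fineTuples hw
      · rw [← Finsupp.lmapDomain_supported]
        exact ⟨x, hx, rfl⟩
    rw [TupleChain.subdiv_single, TupleChain.bdry_single, map_sum, map_sum]
    refine Submodule.sum_mem _ fun k _ => ?_
    rw [map_smul, map_smul]
    exact Submodule.smul_mem _ _ (hcone k _ (ih _))

/-- Tuples of diameter at most `r`. -/
def diamLE (ι : Type*) [Fintype ι] (m : ℕ) (r : ℝ) : Set (Fin m → stdSimplex ℝ ι) :=
  {w | ∀ i j, dist (w i) (w j) ≤ r}

theorem subdiv_mem_supported_diamLE {m : ℕ} {r : ℝ} {x : TupleChain (stdSimplex ℝ ι) m}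
    (hx : x ∈ Finsupp.supported ℤ ℤ (diamLE ι m r)) :
    TupleChain.subdiv bary m x ∈ Finsupp.supported ℤ ℤ (diamLE ι m ((1 - 1 / (m : ℝ)) * r)) := by
  rw [Finsupp.supported_eq_span_single] at hx
  induction hx using Submodule.span_induction with
  | mem x hx =>
    obtain ⟨v, hv, rfl⟩ := hx
    exact Finsupp.supported_mono (fun w hw => hw.2 r hv) (subdiv_single_mem m v)
  | zero => rw [map_zero]; exact Submodule.zero_mem _
  | add x y _ _ hx hy => rw [map_add]; exact Submodule.add_mem _ hx hy
  | smul c x _ hx => rw [map_smul]; exact Submodule.smul_mem _ _ hx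

theorem iterate_subdiv_mem (m k : ℕ) (v : Fin m → stdSimplex ℝ ι) :
    (TupleChain.subdiv bary m)^[k] (Finsupp.single v 1) ∈
      Finsupp.supported ℤ ℤ (diamLE ι m ((1 - 1 / (m : ℝ)) ^ k)) := by
  induction k with
  | zero =>
    refine Finsupp.single_mem_supported ℤ 1 fun i j => ?_
    -- The starting bound `1` bounds the diameter of the whole standard simplex.
    rw [pow_zero, Subtype.dist_eq]
    exact (Metric.dist_le_diam_of_mem (bounded_stdSimplex ι) (v i).2 (v j).2).trans
      diam_stdSimplex_le
  | succ k ih =>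
    rw [Function.iterate_succ_apply', pow_succ']
    exact subdiv_mem_supported_diamLE ih

end stdSimplex

/-! ### Lebesgue numbers of interior covers -/

theorem ClosureSpace.Cont.preimage_mem_nhds {X : Type u} [ClosureSpace X] {T : Type v} [TopologicalSpace T] {σ : T → X}
    (hσ : @Cont T X (ofTopology T) _ σ) {A : Set X} {t : T} (ht : σ t ∈ int A) :
    σ ⁻¹' A ∈ nhds t := by
  let := ofTopology T
  have h : t ∈ (closure (σ ⁻¹' A)ᶜ)ᶜ := hσ.preimage ht
  rw [← interior_eq_compl_closure_compl] at h
  exact mem_interior_iff_mem_nhds.1 h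

/-- The interior of `A` in `X` need not be open, since closure is not assumed idempotent. The open
cover consists instead of the interiors, taken in `T`, of the preimages of `A` and `B`. -/
theorem ClosureSpace.IsInteriorCover.exists_lebesgue_number {X : Type u} [ClosureSpace X]
    {T : Type v} [PseudoMetricSpace T] [CompactSpace T] {A B : Set X}
    (hAB : IsInteriorCover ({A, B} : Set (Set X))) {σ : T → X}
    (hσ : @Cont T X (ofTopology T) _ σ) :
    ∃ δ > 0, ∀ t, (∀ s, dist s t < δ → σ s ∈ A) ∨ ∀ s, dist s t < δ → σ s ∈ B := by
  obtain ⟨δ, hδ, h⟩ := lebesgue_number_lemma_of_metric (s := (Set.univ : Set T))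
    (c := fun b : Bool => interior (σ ⁻¹' (if b then A else B))) isCompact_univ
    (fun _ => isOpen_interior) (fun t _ => by
      rw [Set.mem_iUnion]
      rcases hAB.mem_or_mem (σ t) with h | h
      · exact ⟨true, mem_interior_iff_mem_nhds.2 (hσ.preimage_mem_nhds h)⟩
      · exact ⟨false, mem_interior_iff_mem_nhds.2 (hσ.preimage_mem_nhds h)⟩)
  refine ⟨δ, hδ, fun t => ?_⟩
  obtain ⟨b, hb⟩ := h t trivial
  have hb' : ∀ s, dist s t < δ → s ∈ σ ⁻¹' (if b then A else B) :=
    fun s hs => interior_subset (hb hs)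
  cases b
  · exact Or.inr hb'
  · exact Or.inl hb'

/-! ### Mayer–Vietoris for singular simplicial homology -/

section SimplicialMayerVietoris

open Simplicial

namespace SimplexChain

variable (J : CInterval) {X : Type u} [ClosureSpace X]

/-- The boundary of a singular simplicial chain. -/
noncomputable def bdry (X : Type u) [ClosureSpace X] (n : ℕ) :
    (CMap (J.simplex.obj ⦋n + 1⦌) X →₀ ℤ) →ₗ[ℤ] (CMap (J.simplex.obj ⦋n⦌) X →₀ ℤ) :=
  ∑ k : Fin (n + 2), (-1 : ℤ) ^ (k : ℕ) •
    Finsupp.lmapDomain ℤ ℤ (fun σ => σ.comp (J.simplex.map (SimplexCategory.δ k)))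

theorem d_eq (n : ℕ) (c : CMap (J.simplex.obj ⦋n + 1⦌) X →₀ ℤ) :
    ((simplicialChains J).obj (Cl.of X)).d (n + 1) n c = bdry J X n c := by
  have h : ((simplicialChains J).obj (Cl.of X)).d (n + 1) n = ModuleCat.ofHom (bdry J X n) := by
    refine (AlgebraicTopology.alternatingFaceMapComplex_obj_d _ n).trans ?_
    apply ModuleCat.hom_ext
    rw [AlgebraicTopology.AlternatingFaceMapComplex.objD, ModuleCat.hom_sum]
    rfl
  rw [h]
  rfl

theorem mem_smallChains {A B : Set X} {n : ℕ} {c : CMap (J.simplex.obj ⦋n⦌) X →₀ ℤ}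
    (hc : c ∈ Finsupp.supported ℤ ℤ (CMap.small (J.simplex.obj ⦋n⦌) A B)) :
    c ∈ smallChains (simplicialChains J) A B n := by
  obtain ⟨a, b, h⟩ := CMap.exists_of_mem_supported_small hc
  exact _root_.mem_smallChains.2 ⟨a, b, h⟩

theorem supported_of_mem_smallChains {A B : Set X} {n : ℕ} {c : CMap (J.simplex.obj ⦋n⦌) X →₀ ℤ}
    (hc : c ∈ smallChains (simplicialChains J) A B n) :
    c ∈ Finsupp.supported ℤ ℤ (CMap.small (J.simplex.obj ⦋n⦌) A B) := by
  obtain ⟨a, b, h⟩ := _root_.mem_smallChains.1 hc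
  rw [← h]
  exact CMap.mapDomain_add_mem_supported_small a b

/-- The map of topological simplices with given vertices. -/
noncomputable def affineMap {m n : ℕ} (w : Fin (m + 1) → stdSimplex ℝ (Fin (n + 1))) :
    CMap (CInterval.I.simplex.obj ⦋m⦌) (CInterval.I.simplex.obj ⦋n⦌) where
  toFun := stdSimplex.affine w
  cont := (topToCl.map (TopCat.ofHom ⟨_, stdSimplex.continuous_affine w⟩)).cont

/-- The singular chain of `X` obtained from a chain of tuples in the domain of a simplex. -/
noncomputable def push {n : ℕ} (σ : CMap (CInterval.I.simplex.obj ⦋n⦌) X) (m : ℕ) :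
    TupleChain (stdSimplex ℝ (Fin (n + 1))) (m + 1) →ₗ[ℤ]
      (CMap (CInterval.I.simplex.obj ⦋m⦌) X →₀ ℤ) :=
  Finsupp.lmapDomain ℤ ℤ (fun w => σ.comp (affineMap w))

theorem push_single {n : ℕ} (σ : CMap (CInterval.I.simplex.obj ⦋n⦌) X) (m : ℕ)
    (w : Fin (m + 1) → stdSimplex ℝ (Fin (n + 1))) :
    push σ m (Finsupp.single w 1) = Finsupp.single (σ.comp (affineMap w)) 1 :=
  Finsupp.mapDomain_single

theorem affineMap_vertices {n : ℕ} (σ : CMap (CInterval.I.simplex.obj ⦋n⦌) X) :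
    σ.comp (affineMap stdSimplex.vertex) = σ := by
  apply CMap.ext
  funext t
  exact congrArg σ.toFun (stdSimplex.affine_vertices t)

theorem affineMap_comp {l m n : ℕ} (v : Fin (m + 1) → stdSimplex ℝ (Fin (n + 1)))
    (w : Fin (l + 1) → stdSimplex ℝ (Fin (m + 1))) :
    (affineMap v).comp (affineMap w) = affineMap (stdSimplex.affine v ∘ w) := by
  apply CMap.ext
  funext t
  exact stdSimplex.affine_affine v w t

theorem map_eq_affineMap {m n : ℕ} (f : ⦋m⦌ ⟶ ⦋n⦌) :
    CInterval.I.simplex.map f = affineMap (stdSimplex.vertex ∘ f) := by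
  apply CMap.ext
  funext t
  exact stdSimplex.map_eq_affine _ t

/-- A coface is the affine map on all vertices but one, so composing an affine simplex with it omits
one entry of its tuple. -/
theorem bdry_push {n : ℕ} (σ : CMap (CInterval.I.simplex.obj ⦋n⦌) X) (m : ℕ)
    (x : TupleChain (stdSimplex ℝ (Fin (n + 1))) (m + 2)) :
    bdry .I X m (push σ (m + 1) x) = push σ m (TupleChain.bdry _ (m + 1) x) := by
  simp only [bdry, push, TupleChain.bdry, LinearMap.sum_apply, LinearMap.smul_apply, map_sum,
    map_smul, Finsupp.lmapDomain_apply, ← Finsupp.mapDomain_comp]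
  refine Finset.sum_congr rfl fun k _ => ?_
  congr 2
  funext w
  change σ.comp ((affineMap w).comp (CInterval.I.simplex.map (SimplexCategory.δ k))) =
    σ.comp (affineMap (w ∘ k.succAbove))
  rw [map_eq_affineMap, affineMap_comp]
  congr 2
  funext j
  exact stdSimplex.affine_vertex _ _

theorem push_comp {l m n : ℕ} (σ : CMap (CInterval.I.simplex.obj ⦋n⦌) X)
    (v : Fin (m + 1) → stdSimplex ℝ (Fin (n + 1)))
    (x : TupleChain (stdSimplex ℝ (Fin (m + 1))) (l + 1)) :
    push (σ.comp (affineMap v)) l x = push σ l (TupleChain.map (stdSimplex.affine v) _ x) := by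
  simp only [push, TupleChain.map, Finsupp.lmapDomain_apply, ← Finsupp.mapDomain_comp]
  congr 1
  funext w
  exact congrArg (CMap.comp σ) (affineMap_comp v w)

/-- The operator on singular chains induced by a chain of tuples in each standard simplex. -/
noncomputable def operator (X : Type u) [ClosureSpace X] {m n : ℕ}
    (e : TupleChain (stdSimplex ℝ (Fin (n + 1))) (m + 1)) :
    (CMap (CInterval.I.simplex.obj ⦋n⦌) X →₀ ℤ) →ₗ[ℤ]
      (CMap (CInterval.I.simplex.obj ⦋m⦌) X →₀ ℤ) :=
  Finsupp.linearCombination ℤ fun σ => push σ m e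

theorem operator_single {m n : ℕ} (e : TupleChain (stdSimplex ℝ (Fin (n + 1))) (m + 1))
    (σ : CMap (CInterval.I.simplex.obj ⦋n⦌) X) :
    operator X e (Finsupp.single σ 1) = push σ m e := by
  simp [operator, Finsupp.linearCombination_single]

theorem operator_mem {A B : Set X} {m n : ℕ}
    (e : TupleChain (stdSimplex ℝ (Fin (n + 1))) (m + 1))
    {c : CMap (CInterval.I.simplex.obj ⦋n⦌) X →₀ ℤ}
    (hc : c ∈ Finsupp.supported ℤ ℤ (CMap.small (CInterval.I.simplex.obj ⦋n⦌) A B)) :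
    operator X e c ∈ Finsupp.supported ℤ ℤ (CMap.small (CInterval.I.simplex.obj ⦋m⦌) A B) := by
  rw [Finsupp.supported_eq_span_single] at hc
  induction hc using Submodule.span_induction with
  | mem x hx =>
    obtain ⟨σ, hσ, rfl⟩ := hx
    rw [operator_single]
    refine Finsupp.supported_mono ?_ ((Finsupp.lmapDomain_supported ℤ ℤ
      (fun w => σ.comp (affineMap w)) Set.univ).le ⟨e, Finsupp.supported_univ.ge trivial, rfl⟩)
    rintro _ ⟨w, -, rfl⟩
    exact hσ.imp (fun h z => h _) (fun h z => h _)
  | zero => rw [map_zero]; exact Submodule.zero_mem _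
  | add x y _ _ hx hy => rw [map_add]; exact Submodule.add_mem _ hx hy
  | smul c x _ hx => rw [map_smul]; exact Submodule.smul_mem _ _ hx

/-- The tautological tuple of vertices. -/
noncomputable def vertices (n : ℕ) : TupleChain (stdSimplex ℝ (Fin (n + 1))) (n + 1) :=
  Finsupp.single stdSimplex.vertex 1

theorem map_vertices {m n : ℕ} (v : Fin (m + 1) → stdSimplex ℝ (Fin (n + 1))) :
    TupleChain.map (stdSimplex.affine v) (m + 1) (vertices m) = Finsupp.single v 1 := by
  rw [vertices, TupleChain.map_single]
  congr 1
  funext j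
  exact stdSimplex.affine_vertex v j

/-- Barycentric subdivision of singular chains. -/
noncomputable def subdiv (X : Type u) [ClosureSpace X] (n : ℕ) :=
  operator X (TupleChain.subdiv stdSimplex.bary (n + 1) (vertices n))

/-- The homotopy from barycentric subdivision to the identity. -/
noncomputable def homotopy (X : Type u) [ClosureSpace X] (n : ℕ) :=
  operator X (TupleChain.homotopy stdSimplex.bary (n + 1) (vertices n))

/-- The singular subdivision is computed on the tuple of vertices; naturality under affine maps
shows that it agrees with the tuple subdivision everywhere. As every generator is a push by
`single_eq_push`, identities of tuple chains carry over to singular chains. -/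
theorem subdiv_push {m n : ℕ} (σ : CMap (CInterval.I.simplex.obj ⦋n⦌) X)
    (x : TupleChain (stdSimplex ℝ (Fin (n + 1))) (m + 1)) :
    subdiv X m (push σ m x) = push σ m (TupleChain.subdiv stdSimplex.bary (m + 1) x) := by
  refine Finsupp.linearMap_apply_eq_of_single (f := subdiv X m ∘ₗ push σ m)
    (g := push σ m ∘ₗ TupleChain.subdiv stdSimplex.bary (m + 1)) (fun v => ?_) x
  simp only [LinearMap.comp_apply]
  rw [push_single, subdiv, operator_single, push_comp,
    TupleChain.map_subdiv (stdSimplex.affine_bary v), map_vertices]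

theorem homotopy_push {m n : ℕ} (σ : CMap (CInterval.I.simplex.obj ⦋n⦌) X)
    (x : TupleChain (stdSimplex ℝ (Fin (n + 1))) (m + 1)) :
    homotopy X m (push σ m x) = push σ (m + 1) (TupleChain.homotopy stdSimplex.bary (m + 1) x) := by
  refine Finsupp.linearMap_apply_eq_of_single (f := homotopy X m ∘ₗ push σ m)
    (g := push σ (m + 1) ∘ₗ TupleChain.homotopy stdSimplex.bary (m + 1)) (fun v => ?_) x
  simp only [LinearMap.comp_apply]
  rw [push_single, homotopy, operator_single, push_comp,
    TupleChain.map_homotopy (stdSimplex.affine_bary v), map_vertices]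

theorem single_eq_push {n : ℕ} (σ : CMap (CInterval.I.simplex.obj ⦋n⦌) X) :
    Finsupp.single σ 1 = push σ n (vertices n) := by
  rw [vertices, push_single, affineMap_vertices]

theorem bdry_subdiv (n : ℕ) (c : CMap (CInterval.I.simplex.obj ⦋n + 1⦌) X →₀ ℤ) :
    bdry .I X n (subdiv X (n + 1) c) = subdiv X n (bdry .I X n c) := by
  refine Finsupp.linearMap_apply_eq_of_single (f := bdry .I X n ∘ₗ subdiv X (n + 1))
    (g := subdiv X n ∘ₗ bdry .I X n) (fun σ => ?_) c
  simp only [LinearMap.comp_apply]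
  rw [single_eq_push, subdiv_push, bdry_push, bdry_push, subdiv_push, TupleChain.bdry_subdiv]

theorem bdry_homotopy_zero (c : CMap (CInterval.I.simplex.obj ⦋0⦌) X →₀ ℤ) :
    bdry .I X 0 (homotopy X 0 c) = c - subdiv X 0 c := by
  refine Finsupp.linearMap_apply_eq_of_single (f := bdry .I X 0 ∘ₗ homotopy X 0)
    (g := LinearMap.id - subdiv X 0) (fun σ => ?_) c
  simp only [LinearMap.comp_apply, LinearMap.sub_apply, LinearMap.id_apply]
  rw [single_eq_push, homotopy_push, bdry_push, subdiv_push, ← map_sub,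
    ← TupleChain.bdry_homotopy]
  -- The extra term of the tuple formula passes through the empty tuple, where the homotopy is zero.
  simp [TupleChain.homotopy]

theorem bdry_homotopy_succ (n : ℕ) (c : CMap (CInterval.I.simplex.obj ⦋n + 1⦌) X →₀ ℤ) :
    bdry .I X (n + 1) (homotopy X (n + 1) c) + homotopy X n (bdry .I X n c) =
      c - subdiv X (n + 1) c := by
  refine Finsupp.linearMap_apply_eq_of_single (f := bdry .I X (n + 1) ∘ₗ homotopy X (n + 1) +
    homotopy X n ∘ₗ bdry .I X n) (g := LinearMap.id - subdiv X (n + 1)) (fun σ => ?_) c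
  simp only [LinearMap.comp_apply, LinearMap.sub_apply, LinearMap.id_apply, LinearMap.add_apply]
  rw [single_eq_push, homotopy_push, bdry_push, bdry_push, homotopy_push, subdiv_push, ← map_sub,
    ← map_add, TupleChain.bdry_homotopy]

theorem iterate_subdiv_push {n : ℕ} (σ : CMap (CInterval.I.simplex.obj ⦋n⦌) X) (k : ℕ)
    (x : TupleChain (stdSimplex ℝ (Fin (n + 1))) (n + 1)) :
    (subdiv X n)^[k] (push σ n x) =
      push σ n ((TupleChain.subdiv stdSimplex.bary (n + 1))^[k] x) := by
  induction k generalizing x with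
  | zero => rfl
  | succ k ih => rw [Function.iterate_succ_apply, Function.iterate_succ_apply, subdiv_push, ih]

/-- Asking for all `k ≥ m` allows the bounds for two summands to be combined by their maximum. -/
theorem exists_iterate_subdiv_mem {A B : Set X} (hAB : IsInteriorCover ({A, B} : Set (Set X)))
    (n : ℕ) (c : CMap (CInterval.I.simplex.obj ⦋n⦌) X →₀ ℤ) :
    ∃ m, ∀ k ≥ m, (subdiv X n)^[k] c ∈
      Finsupp.supported ℤ ℤ (CMap.small (CInterval.I.simplex.obj ⦋n⦌) A B) := by
  have hpow : ∀ k, (subdiv X n)^[k] = ⇑(subdiv X n ^ k) := fun k => (Module.End.coe_pow _ k).symm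
  induction c using Finsupp.induction_linear with
  | zero => exact ⟨0, fun k _ => by rw [hpow, map_zero]; exact Submodule.zero_mem _⟩
  | add x y hx hy =>
    obtain ⟨m, hm⟩ := hx
    obtain ⟨m', hm'⟩ := hy
    refine ⟨max m m', fun k hk => ?_⟩
    rw [hpow, map_add, ← hpow]
    exact Submodule.add_mem _ (hm k (le_of_max_le_left hk)) (hm' k (le_of_max_le_right hk))
  | single σ r =>
    have hσ : @Cont (stdSimplex ℝ (Fin (n + 1))) X (ofTopology _) _ σ.toFun := σ.cont
    obtain ⟨δ, hδ, h⟩ := hAB.exists_lebesgue_number hσ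
    have hρ : (1 - 1 / ((n + 1 : ℕ) : ℝ)) < 1 := by
      have : (0 : ℝ) < 1 / ((n + 1 : ℕ) : ℝ) := by positivity
      linarith
    have hρ0 : 0 ≤ (1 - 1 / ((n + 1 : ℕ) : ℝ)) := by
      rw [sub_nonneg, div_le_one (by positivity)]
      push_cast
      linarith [(Nat.cast_nonneg n : (0 : ℝ) ≤ n)]
    obtain ⟨m, hm⟩ := exists_pow_lt_of_lt_one hδ hρ
    refine ⟨m, fun k hk => ?_⟩
    have hk' := (pow_le_pow_of_le_one hρ0 hρ.le hk).trans_lt hm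
    rw [← mul_one r, ← smul_eq_mul, ← Finsupp.smul_single, hpow, map_smul, ← hpow, single_eq_push,
      iterate_subdiv_push]
    refine Submodule.smul_mem _ _ (Finsupp.supported_mono ?_ ((Finsupp.lmapDomain_supported ℤ ℤ
      (fun w => σ.comp (affineMap w)) _).le ⟨_, stdSimplex.iterate_subdiv_mem (n + 1) k _, rfl⟩))
    rintro _ ⟨w, hw, rfl⟩
    -- All vertices are within the diameter bound of `w 0`; by convexity so is the whole affine
    -- simplex.
    have hball : ∀ t, dist (stdSimplex.affine w t) (w 0) < δ := by
      intro t
      rw [dist_comm]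
      exact (stdSimplex.dist_affine_le_of_forall (fun j => hw 0 j) t).trans_lt hk'
    exact (h (w 0)).imp (fun h t => h _ (hball t)) (fun h t => h _ (hball t))

end SimplexChain

theorem hasMayerVietorisSequence_simplicialChains (J : CInterval) {X : Type u} [ClosureSpace X]
    {A B : Set X} (hAB : IsInteriorCover ({A, B} : Set (Set X))) :
    HasMayerVietorisSequence (simplicialChains J) A B := by
  refine hasMayerVietorisSequence_of_acyclic _ A B
    (fun n => Finsupp.mapDomain_injective (CMap.comp_incl_injective _))
    (fun n a b h => CMap.exists_of_mapDomain_add_eq_zero h) ?_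
  -- With a dominated vertex in each simplex every chain is small, so no correction is needed and `w
  -- = 0`. The last vertex serves for `J₊` and for `J₁`.
  have of_dominated (p : ∀ n, J.simplex.obj ⦋n⦌) (hp : ∀ n z, p n ∈ cl {z}) (n : ℕ)
      (z : ((simplicialChains J).obj (Cl.of X)).X n) :
      ∃ w, z - ((simplicialChains J).obj (Cl.of X)).d (n + 1) n w ∈
        smallChains (simplicialChains J) A B n :=
    ⟨0, SimplexChain.mem_smallChains J fun σ _ =>
      CMap.mem_small_of_forall_mem_cl hAB (p n) (hp n) σ⟩
  cases J with
  | Jplus =>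
    exact fun n z _ => of_dominated (fun n => Fin.last n)
      (fun n z => ⟨z, rfl, Fin.le_last (z : Fin (n + 1))⟩) n z
  | Jone => exact fun n z _ => of_dominated (fun n => Fin.last n) (fun n z => ⟨z, rfl⟩) n z
  | I =>
    refine ChainComplex.acyclic_of_subdivision _ (fun n => SimplexChain.subdiv X n)
      (fun n => SimplexChain.homotopy X n) ?_ ?_ ?_ ?_ ?_ ?_
    · intro n x
      exact (SimplexChain.d_eq _ n _).trans ((SimplexChain.bdry_subdiv n x).trans
        (congrArg (SimplexChain.subdiv X n) (SimplexChain.d_eq _ n x).symm))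
    · intro x
      exact (SimplexChain.d_eq _ 0 _).trans (SimplexChain.bdry_homotopy_zero x)
    · intro n x
      refine (congrArg₂ (fun a b : CMap (CInterval.I.simplex.obj ⦋n + 1⦌) X →₀ ℤ => a + b)
        (SimplexChain.d_eq _ (n + 1) _)
        (congrArg (SimplexChain.homotopy X n) (SimplexChain.d_eq _ n x))).trans ?_
      exact SimplexChain.bdry_homotopy_succ n x
    · intro n x hx
      exact SimplexChain.mem_smallChains _ (SimplexChain.operator_mem _
        (SimplexChain.supported_of_mem_smallChains _ hx))
    · intro n x hx
      exact SimplexChain.mem_smallChains _ (SimplexChain.operator_mem _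
        (SimplexChain.supported_of_mem_smallChains _ hx))
    · intro n x
      obtain ⟨m, hm⟩ := SimplexChain.exists_iterate_subdiv_mem hAB n x
      exact ⟨m, SimplexChain.mem_smallChains _ (hm m le_rfl)⟩

end SimplicialMayerVietoris

/-! ### Topological cubes -/

/-- The cubes carry the product closure; this identifies it with the closure of the product
topology, so that compactness and metric arguments apply. -/
theorem ClosureSpace.cl_pi_ofTopology {ι : Type v} {T : ι → Type u} [∀ i, TopologicalSpace (T i)]
    (S : Set (∀ i, T i)) :
    (@ClosureSpace.pi ι T (fun i => ofTopology (T i))).cl S = closure S := by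
  have hint : ∀ i (V : Set (T i)), @int (T i) (ofTopology (T i)) V = interior V := fun i V =>
    interior_eq_compl_closure_compl.symm
  ext x
  rw [mem_closure_iff_nhds]
  constructor
  · intro h t ht
    rw [nhds_pi, Filter.mem_pi] at ht
    obtain ⟨I, hI, V, hV, hVt⟩ := ht
    obtain ⟨y, hy, hyV⟩ := h hI.toFinset V (fun i _ => by
      rw [hint]
      exact mem_interior_iff_mem_nhds.2 (hV i))
    exact ⟨y, hVt fun i hi => hyV i (hI.mem_toFinset.2 hi), hy⟩
  · intro h F V hV
    obtain ⟨y, hyV, hy⟩ := h ((F : Set ι).pi V) (set_pi_mem_nhds F.finite_toSet fun i hi => by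
      have := hV i hi
      rw [hint] at this
      exact mem_interior_iff_mem_nhds.1 this)
    exact ⟨y, hy, hyV⟩

namespace CInterval

theorem cl_cube {n : ℕ} (S : Set (CInterval.I.Cube n)) :
    cl S = closure (X := Fin n → unitInterval) S :=
  cl_pi_ofTopology (T := fun _ : Fin n => unitInterval) S

/-- A continuous map of topological cubes, as a map of closure spaces. -/
def cubeMap {m n : ℕ} (f : (Fin m → unitInterval) → (Fin n → unitInterval)) (hf : Continuous f) :
    CMap (CInterval.I.Cube m) (CInterval.I.Cube n) where
  toFun := f
  cont S := by
    rw [cl_cube, cl_cube]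
    exact image_closure_subset_closure_image (X := Fin m → unitInterval)
      (Y := Fin n → unitInterval) hf

theorem cont_ofTopology {X : Type u} [ClosureSpace X] {n : ℕ} (σ : CMap (CInterval.I.Cube n) X) :
    @Cont (Fin n → unitInterval) X (ofTopology _) _ σ.toFun := by
  rintro S _ ⟨x, hx, rfl⟩
  exact σ.cont S ⟨x, (cl_cube S).ge hx, rfl⟩

/-- The projection of a cube that forgets the coordinate `k`. -/
def proj (J : CInterval) {n : ℕ} (k : Fin (n + 1)) : CMap (J.Cube (n + 1)) (J.Cube n) where
  toFun a := k.removeNth a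
  cont := Cont.toPi fun i => Cont.eval
    (X := fun _ : Fin (n + 1) => (J.space : Type)) (k.succAbove i)

theorem proj_comp_face (J : CInterval) {n : ℕ} (k : Fin (n + 1)) (ε : Fin 2) :
    (J.proj k).comp (J.face k ε) = CMap.id _ := by
  apply CMap.ext
  funext a
  exact Fin.removeNth_insertNth (α := fun _ => J.space) k _ a

theorem face_comp_proj_apply (J : CInterval) {n : ℕ} (k : Fin (n + 1)) (ε : Fin 2)
    (a : J.Cube (n + 1)) :
    ((J.face k ε).comp (J.proj k)).toFun a = Function.update a k (J.endpoint ε) :=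
  Fin.insertNth_removeNth (α := fun _ => J.space) k _ a

end CInterval

/-! ### Splitting normalized cubical chains -/

namespace CubeChain

variable {J : CInterval} {X : Type u} [ClosureSpace X]

/-- Extend a singular cube to be constant in the new coordinate `k`. -/
noncomputable def degen {n : ℕ} (k : Fin (n + 1)) : CubeChain J X n →ₗ[ℤ] CubeChain J X (n + 1) :=
  Finsupp.lmapDomain ℤ ℤ (fun σ => σ.comp (J.proj k))

theorem degen_map {Y : Type v} [ClosureSpace Y] (f : CMap X Y) {n : ℕ} (k : Fin (n + 1))
    (c : CubeChain J X n) : degen k (map f n c) = map f (n + 1) (degen k c) := by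
  simp only [degen, map, Finsupp.lmapDomain_apply, ← Finsupp.mapDomain_comp]
  rfl

theorem d_degen {n : ℕ} (k : Fin (n + 1)) (ε : Fin 2) (c : CubeChain J X n) :
    d J X k ε (degen k c) = c := by
  simp only [d, degen, Finsupp.lmapDomain_apply, ← Finsupp.mapDomain_comp]
  refine Eq.trans ?_ Finsupp.mapDomain_id
  congr 1
  funext σ
  exact congrArg (CMap.comp σ) (J.proj_comp_face k ε)

/-- Following `d J X k ε` by `degen k` freezes the coordinate `k` at `ε`, and freezing two
coordinates can be done in either order. -/
theorem degen_d_comm {n : ℕ} (j k : Fin (n + 1)) (ε : Fin 2) (c : CubeChain J X (n + 1)) :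
    degen j (d J X j ε (degen k (d J X k ε c))) = degen k (d J X k ε (degen j (d J X j ε c))) := by
  simp only [d, degen, Finsupp.lmapDomain_apply, ← Finsupp.mapDomain_comp]
  congr 1
  funext σ
  apply CMap.ext
  funext a
  change σ.toFun (((J.face k ε).comp (J.proj k)).toFun (((J.face j ε).comp (J.proj j)).toFun a)) =
    σ.toFun (((J.face j ε).comp (J.proj j)).toFun (((J.face k ε).comp (J.proj k)).toFun a))
  simp only [CInterval.face_comp_proj_apply]
  rcases eq_or_ne j k with rfl | h
  · rfl
  · rw [Function.update_comm h]

/-- Making the face `k` vanish by subtracting the frozen chain does not spoil a face `j` that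
already vanishes, since the freezing operators commute and `degen j` has a left inverse. -/
theorem d_sub_degen {n : ℕ} (j k : Fin (n + 1)) (ε : Fin 2) {c : CubeChain J X (n + 1)}
    (hc : d J X j ε c = 0) : d J X j ε (c - degen k (d J X k ε c)) = 0 := by
  have h : d J X j ε (degen k (d J X k ε c)) = 0 := by
    rw [← d_degen j ε (d J X j ε (degen k (d J X k ε c))), degen_d_comm, hc]
    simp
  rw [map_sub, hc, h, sub_zero]

/-- A normalized chain that is a sum of a chain of `A` and a chain of `B` is a sum of normalized
chains. -/
theorem exists_normalized {A B : Set X} {n : ℕ} {c : CubeChain J X n} (hc : c ∈ normalized J X n)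
    (hs : c ∈ Finsupp.supported ℤ ℤ (CMap.small (J.Cube n) A B)) :
    ∃ a ∈ normalized J A n, ∃ b ∈ normalized J B n,
      map (Cl.val A) n a + map (Cl.val B) n b = c := by
  obtain ⟨a, b, h⟩ := CMap.exists_of_mem_supported_small hs
  cases n with
  | zero => exact ⟨a, trivial, b, trivial, h⟩
  | succ n =>
    simp only [normalized, Submodule.mem_iInf, LinearMap.mem_ker] at hc ⊢
    -- The faces are killed one coordinate at a time. The two subtracted chains sum to zero in `X`,
    -- because the face `k` of `c` vanishes, so the total stays `c`.
    have key : ∀ F : Finset (Fin (n + 1)),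
        ∃ (a : CubeChain J A (n + 1)) (b : CubeChain J B (n + 1)),
        map (Cl.val A) _ a + map (Cl.val B) _ b = c ∧
          ∀ k ∈ F, d J A k 1 a = 0 ∧ d J B k 1 b = 0 := by
      intro F
      induction F using Finset.induction_on with
      | empty => exact ⟨a, b, h, by simp⟩
      | insert k F _ ih =>
        obtain ⟨a, b, h, h'⟩ := ih
        refine ⟨a - degen k (d J A k 1 a), b - degen k (d J B k 1 b), ?_, ?_⟩
        · have h0 := hc k
          rw [← h, map_add, d_map, d_map] at h0
          rw [map_sub, map_sub, ← degen_map, ← degen_map, sub_add_sub_comm, ← map_add, h0,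
            map_zero, sub_zero, h]
        · intro j hj
          rcases Finset.mem_insert.1 hj with rfl | hj
          · simp only [map_sub, d_degen, sub_self, and_self]
          · exact ⟨d_sub_degen j k 1 (h' j hj).1, d_sub_degen j k 1 (h' j hj).2⟩
    obtain ⟨a, b, h, h'⟩ := key Finset.univ
    exact ⟨a, fun k => (h' k (Finset.mem_univ _)).1, b, fun k => (h' k (Finset.mem_univ _)).2, h⟩

theorem d_eq (n : ℕ) (c : normalized J X (n + 1)) :
    ((cubicalChains J).obj (Cl.of X)).d (n + 1) n c =
      (⟨bdry J X n c.1, bdry_mem c.2⟩ : normalized J X n) := by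
  have h : ((cubicalChains J).obj (Cl.of X)).d (n + 1) n = ModuleCat.ofHom
      ((bdry J X n).restrict (fun _ hc => bdry_mem hc)) := by
    dsimp only [cubicalChains]
    exact ChainComplex.of_d _ _ _
  rw [h]
  rfl

theorem mem_smallChains {A B : Set X} {n : ℕ} {c : normalized J X n}
    (hc : c.1 ∈ Finsupp.supported ℤ ℤ (CMap.small (J.Cube n) A B)) :
    c ∈ smallChains (cubicalChains J) A B n := by
  obtain ⟨a, ha, b, hb, h⟩ := exists_normalized c.2 hc
  exact _root_.mem_smallChains.2 ⟨⟨a, ha⟩, ⟨b, hb⟩, Subtype.ext h⟩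

theorem supported_of_mem_smallChains {A B : Set X} {n : ℕ} {c : normalized J X n}
    (hc : c ∈ smallChains (cubicalChains J) A B n) :
    c.1 ∈ Finsupp.supported ℤ ℤ (CMap.small (J.Cube n) A B) := by
  obtain ⟨a, b, h⟩ := _root_.mem_smallChains.1 hc
  rw [← h]
  exact CMap.mapDomain_add_mem_supported_small a.1 b.1

theorem mem_normalized_of_map {Y : Type v} [ClosureSpace Y] (f : CMap X Y)
    (hf : ∀ n, Function.Injective (map (J := J) f n)) {n : ℕ} {c : CubeChain J X n}
    (hc : map f n c ∈ normalized J Y n) : c ∈ normalized J X n := by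
  cases n with
  | zero => trivial
  | succ n =>
    simp only [normalized, Submodule.mem_iInf, LinearMap.mem_ker] at hc ⊢
    intro i
    apply hf n
    rw [← d_map, hc, map_zero]

end CubeChain

/-! ### Subdivision of cubical chains

The interval is replaced by the combination (left half) - (midpoint) + (right half) of its maps to
itself, which has the same end points. This commutes with all face operators. -/

namespace CInterval

/-- The values of the three families of maps `I → I`, with parameter `s`; the left half, the
midpoint and the right half for `s = 0`, the identity and twice the constant `1` for `s = 1`. -/
noncomputable def stretchVal (e : Fin 3) (s x : ℝ) : ℝ :=
  ![x * (1 + s) / 2, (1 + s) / 2, (1 + s) / 2 + x * (1 - s) / 2] e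

theorem stretchVal_mem (e : Fin 3) (s x : unitInterval) :
    stretchVal e s x ∈ unitInterval := by
  obtain ⟨s, hs0, hs1⟩ := s
  obtain ⟨x, hx0, hx1⟩ := x
  have h1 : x * s ≤ s := mul_le_of_le_one_left hs0 hx1
  have h2 : 0 ≤ x * s := mul_nonneg hx0 hs0
  have h3 : x * s ≤ x := mul_le_of_le_one_right hx0 hs1
  have h4 : 0 ≤ (1 - x) * (1 - s) := mul_nonneg (by linarith) (by linarith)
  fin_cases e <;> constructor <;> simp [stretchVal] <;> linarith

/-- The three families of maps `I → I` used in the subdivision. -/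
noncomputable def stretch (e : Fin 3) (s x : unitInterval) : unitInterval :=
  ⟨stretchVal e s x, stretchVal_mem e s x⟩

theorem continuous_stretch (e : Fin 3) :
    Continuous (fun p : unitInterval × unitInterval => stretch e p.1 p.2) := by
  refine Continuous.subtype_mk ?_ _
  fin_cases e <;> simp [stretchVal] <;> fun_prop

/-- This and the next three identities say that, for every `s`, the combination of families `0`
minus `1` plus `2` restricts to the end point `0` at `x = 0` and to `1` at `x = 1`; the two other
terms cancel. -/
theorem stretch_zero_zero (s : unitInterval) : stretch 0 s 0 = 0 :=
  Subtype.ext (by simp [stretch, stretchVal])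

theorem stretch_one_zero (s : unitInterval) : stretch 1 s 0 = stretch 2 s 0 :=
  Subtype.ext (by simp [stretch, stretchVal])

theorem stretch_zero_one (s : unitInterval) : stretch 0 s 1 = stretch 1 s 1 :=
  Subtype.ext (by simp [stretch, stretchVal])

theorem stretch_two_one (s : unitInterval) : stretch 2 s 1 = 1 :=
  Subtype.ext (by simp [stretch, stretchVal]; ring)

theorem stretch_zero_at_one (x : unitInterval) : stretch 0 1 x = x :=
  Subtype.ext (by simp [stretch, stretchVal]; ring)

theorem stretch_one_at_one (x : unitInterval) : stretch 1 1 x = stretch 2 1 x :=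
  Subtype.ext (by simp [stretch, stretchVal])

theorem dist_stretch_le (e : Fin 3) (x y : unitInterval) :
    dist (stretch e 0 x) (stretch e 0 y) ≤ 1 / 2 * dist x y := by
  simp only [Subtype.dist_eq, Real.dist_eq, stretch]
  have h : |(x : ℝ) / 2 - y / 2| = 1 / 2 * |(x : ℝ) - y| := by
    rw [← sub_div, abs_div, abs_two]
    ring
  fin_cases e
  · simp [stretchVal] at h ⊢
    exact h.le
  · simp [stretchVal]
  · simp [stretchVal] at h ⊢
    exact h.le

/-- Apply one of the three families to every coordinate, the parameter being the coordinate `0`. -/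
noncomputable def stretchCube {n : ℕ} (e : Fin n → Fin 3) :
    CMap (CInterval.I.Cube (n + 1)) (CInterval.I.Cube n) :=
  cubeMap (fun a i => stretch (e i) (a 0) (a i.succ)) (continuous_pi fun i => by
    have h : Continuous (fun a : Fin (n + 1) → unitInterval => (a 0, a i.succ)) := by fun_prop
    exact (continuous_stretch (e i)).comp h)

/-- The sign with which a combination of the three families occurs in the subdivision. -/
def stretchSign {n : ℕ} (e : Fin n → Fin 3) : ℤ := ∏ i, (![1, -1, 1] : Fin 3 → ℤ) (e i)

theorem sum_stretchSign_smul {M : Type*} [AddCommGroup M] {n : ℕ} (i : Fin (n + 1))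
    (F : (Fin (n + 1) → Fin 3) → M) :
    ∑ e, stretchSign e • F e = ∑ e : Fin n → Fin 3, stretchSign e •
      (F (i.insertNth 0 e) - F (i.insertNth 1 e) + F (i.insertNth 2 e)) := by
  rw [← (Fin.insertNthEquiv (fun _ => Fin 3) i).sum_comp, Fintype.sum_prod_type_right]
  refine Finset.sum_congr rfl fun e _ => ?_
  have h : ∀ x, Fin.insertNthEquiv (fun _ => Fin 3) i (x, e) = i.insertNth x e := fun _ => rfl
  simp only [Fin.sum_univ_three, h, stretchSign,
    Fin.prod_univ_succAbove _ i, Fin.insertNth_apply_same, Fin.insertNth_apply_succAbove]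
  simp [smul_add, sub_eq_add_neg]

/-- If `F` does not distinguish the families `1` and `2`, their opposite signs cancel in each
coordinate and only family `0` survives. This is the situation at `s = 1`, where both are the
constant `1`. -/
theorem sum_stretchSign_smul_of_forall {M : Type*} [AddCommGroup M] {n : ℕ}
    (F : (Fin n → Fin 3) → M) (hF : ∀ e e', (∀ i, e i = 0 ↔ e' i = 0) → F e = F e') :
    ∑ e, stretchSign e • F e = F 0 := by
  induction n with
  | zero =>
    rw [Fintype.sum_unique, stretchSign, Finset.univ_eq_empty, Finset.prod_empty, one_smul]
    exact congrArg F (Subsingleton.elim _ _)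
  | succ n ih =>
    rw [sum_stretchSign_smul 0]
    have h : ∀ e : Fin n → Fin 3, F ((0 : Fin (n + 1)).insertNth 1 e) =
        F ((0 : Fin (n + 1)).insertNth 2 e) := fun e => hF _ _ fun i => by
      refine Fin.cases ?_ (fun i => ?_) i <;> simp
    simp only [h, sub_add_cancel]
    rw [ih (fun e => F ((0 : Fin (n + 1)).insertNth 0 e)) fun e e' hee => hF _ _ fun i => by
      refine Fin.cases ?_ (fun i => ?_) i <;> simp [hee]]
    congr 1
    funext i
    refine Fin.cases ?_ (fun i => ?_) i <;> simp

theorem stretchCube_comp_face {n : ℕ} (i : Fin (n + 1)) (ε : Fin 2) (e : Fin (n + 1) → Fin 3)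
    (a : CInterval.I.Cube (n + 1)) (j : Fin (n + 1)) :
    ((stretchCube e).comp (CInterval.I.face i.succ ε)).toFun a j =
      i.insertNth (α := fun _ => CInterval.I.space)
        (stretch (e i) (a 0) (CInterval.I.endpoint ε) : unitInterval)
        (fun k => stretch (e (i.succAbove k)) (a 0) (a k.succ)) j := by
  -- Coordinate `0` is the parameter; a face in a later direction leaves it alone.
  have h0 : (CInterval.I.face i.succ ε).toFun a 0 = a 0 := by
    have : (0 : Fin (n + 2)) = i.succ.succAbove 0 := by simp
    conv_lhs => rw [this]
    exact Fin.insertNth_apply_succAbove (α := fun _ => CInterval.I.space) i.succ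
      (CInterval.I.endpoint ε) a 0
  change stretch (e j) ((CInterval.I.face i.succ ε).toFun a 0)
    ((CInterval.I.face i.succ ε).toFun a j.succ) = _
  rw [h0]
  rcases Fin.eq_self_or_eq_succAbove i j with rfl | ⟨k, rfl⟩
  · exact (congrArg (stretch (e j) (a 0)) (Fin.insertNth_apply_same
      (α := fun _ => CInterval.I.space) j.succ (CInterval.I.endpoint ε) a)).trans
      (Fin.insertNth_apply_same (α := fun _ => CInterval.I.space) j _ _).symm
  · refine (congrArg (stretch (e (i.succAbove k)) (a 0))
      (?_ : (CInterval.I.face i.succ ε).toFun a (i.succAbove k).succ = a k.succ)).trans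
      (Fin.insertNth_apply_succAbove (α := fun _ => CInterval.I.space) i
        (stretch (e i) (a 0) (CInterval.I.endpoint ε))
        (fun k => stretch (e (i.succAbove k)) (a 0) (a k.succ)) k).symm
    rw [← Fin.succ_succAbove_succ]
    exact Fin.insertNth_apply_succAbove (α := fun _ => CInterval.I.space) i.succ
      (CInterval.I.endpoint ε) a _

end CInterval

namespace CubeChain

variable {X : Type u} [ClosureSpace X]

open CInterval

/-- The cylinder of the subdivision: its face `0` is the subdivision, its face `1` is the
identity. -/
noncomputable def cylinder (X : Type u) [ClosureSpace X] (n : ℕ) :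
    CubeChain .I X n →ₗ[ℤ] CubeChain .I X (n + 1) :=
  ∑ e : Fin n → Fin 3, stretchSign e •
    Finsupp.lmapDomain ℤ ℤ (fun σ => σ.comp (stretchCube e))

theorem cylinder_single {n : ℕ} (σ : CMap (CInterval.I.Cube n) X) :
    cylinder X n (Finsupp.single σ 1) =
      ∑ e : Fin n → Fin 3, stretchSign e • Finsupp.single (σ.comp (stretchCube e)) 1 := by
  simp only [cylinder, LinearMap.sum_apply, LinearMap.smul_apply, Finsupp.lmapDomain_apply,
    Finsupp.mapDomain_single]

theorem d_single {J : CInterval} {n : ℕ} (i : Fin (n + 1)) (ε : Fin 2)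
    (σ : CMap (J.Cube (n + 1)) X) :
    d J X i ε (Finsupp.single σ 1) = Finsupp.single (σ.comp (J.face i ε)) 1 :=
  Finsupp.mapDomain_single

/-- In direction `i`, families `1` and `2` cancel on the face `ε = 0`, and families `0` and `1` on
the face `ε = 1`. The remaining family fixes the end point, which leaves the cylinder of the face.
-/
theorem d_succ_cylinder {n : ℕ} (i : Fin (n + 1)) (ε : Fin 2) (c : CubeChain .I X (n + 1)) :
    d .I X i.succ ε (cylinder X (n + 1) c) = cylinder X n (d .I X i ε c) := by
  refine Finsupp.linearMap_apply_eq_of_single (f := d .I X i.succ ε ∘ₗ cylinder X (n + 1))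
    (g := cylinder X n ∘ₗ d .I X i ε) (fun σ => ?_) c
  simp only [LinearMap.comp_apply]
  rw [d_single, cylinder_single, cylinder_single, map_sum]
  simp only [map_smul, d_single]
  rw [sum_stretchSign_smul i]
  refine Finset.sum_congr rfl fun e _ => ?_
  congr 1
  change Finsupp.single (σ.comp ((stretchCube _).comp (CInterval.I.face i.succ ε))) 1 -
    Finsupp.single (σ.comp ((stretchCube _).comp (CInterval.I.face i.succ ε))) 1 +
    Finsupp.single (σ.comp ((stretchCube _).comp (CInterval.I.face i.succ ε))) 1 =
    Finsupp.single (σ.comp ((CInterval.I.face i ε).comp (stretchCube e))) 1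
  have heq : ∀ k k' : Fin 3, (∀ s, stretch k s (CInterval.I.endpoint ε) =
      stretch k' s (CInterval.I.endpoint ε)) →
      (stretchCube (i.insertNth k e)).comp (CInterval.I.face i.succ ε) =
        (stretchCube (i.insertNth k' e)).comp (CInterval.I.face i.succ ε) := by
    intro k k' h
    apply CMap.ext
    funext a j
    rw [stretchCube_comp_face, stretchCube_comp_face]
    simp only [Fin.insertNth_apply_same, Fin.insertNth_apply_succAbove]
    exact congrArg (fun y => i.insertNth (α := fun _ => CInterval.I.space) y _ j) (h (a 0))
  have hface : ∀ k : Fin 3, (∀ s, stretch k s (CInterval.I.endpoint ε) =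
      CInterval.I.endpoint ε) →
      (stretchCube (i.insertNth k e)).comp (CInterval.I.face i.succ ε) =
        (CInterval.I.face i ε).comp (stretchCube e) := by
    intro k h
    apply CMap.ext
    funext a j
    rw [stretchCube_comp_face]
    simp only [Fin.insertNth_apply_same, Fin.insertNth_apply_succAbove]
    exact congrArg (fun y => i.insertNth (α := fun _ => CInterval.I.space) y _ j) (h (a 0))
  obtain rfl | rfl : ε = 0 ∨ ε = 1 := by fin_cases ε <;> simp
  · rw [heq 1 2 stretch_one_zero, hface 0 stretch_zero_zero, sub_add_cancel]
  · rw [heq 0 1 stretch_zero_one, hface 2 stretch_two_one, sub_self, zero_add]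

theorem d_zero_one_cylinder {n : ℕ} (c : CubeChain .I X n) :
    d .I X 0 1 (cylinder X n c) = c := by
  refine Finsupp.linearMap_apply_eq_of_single (f := d .I X 0 1 ∘ₗ cylinder X n) (g := LinearMap.id)
    (fun σ => ?_) c
  simp only [LinearMap.comp_apply, LinearMap.id_apply]
  rw [cylinder_single, map_sum]
  simp only [map_smul, d_single]
  have happ : ∀ (e : Fin n → Fin 3) a i,
      ((stretchCube e).comp (CInterval.I.face 0 1)).toFun a i = stretch (e i) 1 (a i) := by
    intro e a i
    rfl
  refine (sum_stretchSign_smul_of_forall (M := CubeChain .I X n)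
    (fun e => Finsupp.single ((σ.comp (stretchCube e)).comp (CInterval.I.face 0 1)) 1) ?_).trans ?_
  · intro e e' h
    congr 1
    refine congrArg (CMap.comp σ) (?_ : (stretchCube e).comp (CInterval.I.face 0 1) =
      (stretchCube e').comp (CInterval.I.face 0 1))
    apply CMap.ext
    funext a i
    rw [happ, happ]
    have key : ∀ k : Fin 3, k ≠ 0 → stretch k 1 (a i) = stretch 2 1 (a i) := by
      intro k hk
      fin_cases k
      · exact absurd rfl hk
      · exact stretch_one_at_one _
      · rfl
    by_cases h0 : e i = 0
    · rw [h0, (h i).1 h0]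
    · rw [key _ h0, key _ fun h1 => h0 ((h i).2 h1)]
  · congr 1
    apply CMap.ext
    funext a
    refine congrArg σ.toFun (?_ : ((stretchCube 0).comp (CInterval.I.face 0 1)).toFun a = a)
    funext i
    rw [happ]
    exact stretch_zero_at_one _

/-- The subdivision of cubical chains. -/
noncomputable def subdiv (X : Type u) [ClosureSpace X] (n : ℕ) :
    CubeChain .I X n →ₗ[ℤ] CubeChain .I X n :=
  d .I X 0 0 ∘ₗ cylinder X n

/-- The homotopy from the subdivision to the identity. -/
noncomputable def homotopy (X : Type u) [ClosureSpace X] (n : ℕ) :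
    CubeChain .I X n →ₗ[ℤ] CubeChain .I X (n + 1) :=
  degen 0 - cylinder X n

theorem d_subdiv {n : ℕ} (i : Fin (n + 1)) (ε : Fin 2) (c : CubeChain .I X (n + 1)) :
    d .I X i ε (subdiv X (n + 1) c) = subdiv X n (d .I X i ε c) := by
  have h := d_d (J := .I) (Fin.zero_le i) 0 ε (cylinder X (n + 1) c)
  rw [d_succ_cylinder] at h
  exact h.symm

theorem d_succ_degen {J : CInterval} {n : ℕ} (i : Fin (n + 1)) (ε : Fin 2)
    (c : CubeChain J X (n + 1)) :
    d J X i.succ ε (degen 0 c) = degen 0 (d J X i ε c) := by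
  simp only [d, degen, Finsupp.lmapDomain_apply, ← Finsupp.mapDomain_comp]
  congr 1
  funext σ
  apply CMap.ext
  funext a
  refine congrArg σ.toFun (?_ : (fun k => (J.face i.succ ε).toFun a ((0 : Fin (n + 2)).succAbove k)) =
    (J.face i ε).toFun (fun k => a ((0 : Fin (n + 1)).succAbove k)))
  funext k
  simp only [Fin.zero_succAbove]
  rcases Fin.eq_self_or_eq_succAbove i k with rfl | ⟨l, rfl⟩
  · exact (Fin.insertNth_apply_same (α := fun _ => J.space) k.succ _ a).trans
      (Fin.insertNth_apply_same (α := fun _ => J.space) k (J.endpoint ε)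
        (fun m => a m.succ)).symm
  · rw [← Fin.succ_succAbove_succ]
    exact (Fin.insertNth_apply_succAbove (α := fun _ => J.space) i.succ _ a l.succ).trans
      (Fin.insertNth_apply_succAbove (α := fun _ => J.space) i (J.endpoint ε)
        (fun m => a m.succ) l).symm

theorem d_succ_homotopy {n : ℕ} (i : Fin (n + 1)) (ε : Fin 2) (c : CubeChain .I X (n + 1)) :
    d .I X i.succ ε (homotopy X (n + 1) c) = homotopy X n (d .I X i ε c) := by
  simp only [homotopy, LinearMap.sub_apply, map_sub, d_succ_degen, d_succ_cylinder]

theorem d_zero_zero_homotopy {n : ℕ} (c : CubeChain .I X n) :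
    d .I X 0 0 (homotopy X n c) = c - subdiv X n c := by
  simp only [homotopy, LinearMap.sub_apply, map_sub, d_degen, subdiv, LinearMap.comp_apply]

/-- The face `1` of the cylinder is the original chain; subtracting the cylinder from the degenerate
chain removes this face, which keeps the homotopy normalized. -/
theorem d_zero_one_homotopy {n : ℕ} (c : CubeChain .I X n) :
    d .I X 0 1 (homotopy X n c) = 0 := by
  simp only [homotopy, LinearMap.sub_apply, map_sub, d_degen, d_zero_one_cylinder, sub_self]

theorem subdiv_mem {n : ℕ} {c : CubeChain .I X n} (hc : c ∈ normalized .I X n) :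
    subdiv X n c ∈ normalized .I X n := by
  cases n with
  | zero => trivial
  | succ n =>
    simp only [normalized, Submodule.mem_iInf, LinearMap.mem_ker] at hc ⊢
    intro i
    rw [d_subdiv, hc, map_zero]

theorem homotopy_mem {n : ℕ} {c : CubeChain .I X n} (hc : c ∈ normalized .I X n) :
    homotopy X n c ∈ normalized .I X (n + 1) := by
  simp only [normalized, Submodule.mem_iInf, LinearMap.mem_ker]
  intro i
  refine Fin.cases (d_zero_one_homotopy c) (fun i => ?_) i
  cases n with
  | zero => exact i.elim0
  | succ n =>
    simp only [normalized, Submodule.mem_iInf, LinearMap.mem_ker] at hc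
    rw [d_succ_homotopy, hc, map_zero]

theorem bdry_subdiv (n : ℕ) (c : CubeChain .I X (n + 1)) :
    bdry .I X n (subdiv X (n + 1) c) = subdiv X n (bdry .I X n c) := by
  simp only [bdry, LinearMap.sum_apply, LinearMap.smul_apply, map_sum, map_smul, d_subdiv]

theorem bdry_homotopy_zero (c : CubeChain .I X 0) :
    bdry .I X 0 (homotopy X 0 c) = c - subdiv X 0 c := by
  rw [← d_zero_zero_homotopy]
  simp [bdry]

/-- The face in direction `0` gives the identity minus the subdivision. The other faces commute with
the homotopy, and their index shift by one supplies the minus sign. -/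
theorem bdry_homotopy_succ (n : ℕ) (c : CubeChain .I X (n + 1)) :
    bdry .I X (n + 1) (homotopy X (n + 1) c) + homotopy X n (bdry .I X n c) =
      c - subdiv X (n + 1) c := by
  rw [← d_zero_zero_homotopy]
  simp only [bdry, LinearMap.sum_apply, LinearMap.smul_apply, map_sum, map_smul]
  rw [Fin.sum_univ_succ]
  simp only [d_succ_homotopy, Fin.val_succ, pow_succ, mul_neg_one, neg_smul,
    Finset.sum_neg_distrib, Fin.val_zero, pow_zero, one_smul]
  abel

/-- The cubes obtained by restricting `σ` along maps that contract distances by the factor `r`. -/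
def contractions {n : ℕ} (σ : CMap (CInterval.I.Cube n) X) (r : ℝ) :
    Set (CMap (CInterval.I.Cube n) X) :=
  {τ | ∃ g : CMap (CInterval.I.Cube n) (CInterval.I.Cube n), τ = σ.comp g ∧
    ∀ a b i, dist (α := unitInterval) (g.toFun a i) (g.toFun b i) ≤
      r * dist (α := Fin n → unitInterval) a b}

theorem lmapDomain_small_mem {m n : ℕ} {A B : Set X}
    (g : CMap (CInterval.I.Cube m) (CInterval.I.Cube n))
    {c : CubeChain .I X n} (hc : c ∈ Finsupp.supported ℤ ℤ (CMap.small (CInterval.I.Cube n) A B)) :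
    Finsupp.lmapDomain ℤ ℤ (fun σ => σ.comp g) c ∈
      Finsupp.supported ℤ ℤ (CMap.small (CInterval.I.Cube m) A B) := by
  refine Finsupp.supported_mono ?_ ((Finsupp.lmapDomain_supported ℤ ℤ
    (fun σ : CMap (CInterval.I.Cube n) X => σ.comp g) _).le ⟨c, hc, rfl⟩)
  rintro _ ⟨σ, hσ, rfl⟩
  exact hσ.imp (fun h z => h _) (fun h z => h _)

theorem cylinder_small_mem {n : ℕ} {A B : Set X} {c : CubeChain .I X n}
    (hc : c ∈ Finsupp.supported ℤ ℤ (CMap.small (CInterval.I.Cube n) A B)) :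
    cylinder X n c ∈ Finsupp.supported ℤ ℤ (CMap.small (CInterval.I.Cube (n + 1)) A B) := by
  simp only [cylinder, LinearMap.sum_apply, LinearMap.smul_apply]
  exact Submodule.sum_mem _ fun e _ => Submodule.smul_mem _ _ (lmapDomain_small_mem _ hc)

theorem subdiv_small_mem {n : ℕ} {A B : Set X} {c : CubeChain .I X n}
    (hc : c ∈ Finsupp.supported ℤ ℤ (CMap.small (CInterval.I.Cube n) A B)) :
    subdiv X n c ∈ Finsupp.supported ℤ ℤ (CMap.small (CInterval.I.Cube n) A B) :=
  lmapDomain_small_mem _ (cylinder_small_mem hc)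

theorem homotopy_small_mem {n : ℕ} {A B : Set X} {c : CubeChain .I X n}
    (hc : c ∈ Finsupp.supported ℤ ℤ (CMap.small (CInterval.I.Cube n) A B)) :
    homotopy X n c ∈ Finsupp.supported ℤ ℤ (CMap.small (CInterval.I.Cube (n + 1)) A B) :=
  Submodule.sub_mem _ (lmapDomain_small_mem _ hc) (cylinder_small_mem hc)

/-- At `s = 0` each family contracts by `1 / 2`, so in the sup metric the cube is contracted by `1 /
2` whatever its dimension. -/
theorem subdiv_contractions {n : ℕ} {σ : CMap (CInterval.I.Cube n) X} {r : ℝ} (hr : 0 ≤ r)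
    {c : CubeChain .I X n} (hc : c ∈ Finsupp.supported ℤ ℤ (contractions σ r)) :
    subdiv X n c ∈ Finsupp.supported ℤ ℤ (contractions σ (r * (1 / 2))) := by
  rw [Finsupp.supported_eq_span_single] at hc
  induction hc using Submodule.span_induction with
  | mem x hx =>
    obtain ⟨_, ⟨g, rfl, hg⟩, rfl⟩ := hx
    rw [subdiv, LinearMap.comp_apply, cylinder_single, map_sum]
    refine Submodule.sum_mem _ fun e _ => ?_
    rw [map_smul, d_single]
    refine Submodule.smul_mem _ _ (Finsupp.single_mem_supported ℤ 1
      ⟨g.comp ((stretchCube e).comp (CInterval.I.face 0 0)), rfl, fun a b i => ?_⟩)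
    refine (hg _ _ i).trans ?_
    rw [mul_assoc]
    refine mul_le_mul_of_nonneg_left ?_ hr
    refine (dist_pi_le_iff (X := fun _ : Fin n => unitInterval)
      (mul_nonneg (by norm_num) dist_nonneg)).2 fun j => ?_
    refine (dist_stretch_le (e j) (a j) (b j)).trans (mul_le_mul_of_nonneg_left ?_ (by norm_num))
    exact dist_le_pi_dist (X := fun _ : Fin n => unitInterval) a b j
  | zero => rw [map_zero]; exact Submodule.zero_mem _
  | add x y _ _ hx hy => rw [map_add]; exact Submodule.add_mem _ hx hy
  | smul s x _ hx => rw [map_smul]; exact Submodule.smul_mem _ _ hx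

theorem iterate_subdiv_contractions {n : ℕ} (σ : CMap (CInterval.I.Cube n) X) (k : ℕ) :
    (subdiv X n)^[k] (Finsupp.single σ 1) ∈
      Finsupp.supported ℤ ℤ (contractions σ ((1 / 2) ^ k)) := by
  induction k with
  | zero =>
    refine Finsupp.single_mem_supported ℤ 1 ⟨CMap.id _, rfl, fun a b i => ?_⟩
    rw [pow_zero, one_mul]
    exact dist_le_pi_dist (X := fun _ : Fin n => unitInterval) a b i
  | succ k ih =>
    rw [Function.iterate_succ_apply', pow_succ]
    exact subdiv_contractions (by positivity) ih

theorem exists_iterate_subdiv_mem {A B : Set X} (hAB : IsInteriorCover ({A, B} : Set (Set X)))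
    (n : ℕ) (c : CubeChain .I X n) :
    ∃ m, ∀ k ≥ m, (subdiv X n)^[k] c ∈
      Finsupp.supported ℤ ℤ (CMap.small (CInterval.I.Cube n) A B) := by
  have hpow : ∀ k, (subdiv X n)^[k] = ⇑(subdiv X n ^ k) := fun k => (Module.End.coe_pow _ k).symm
  induction c using Finsupp.induction_linear with
  | zero => exact ⟨0, fun k _ => by rw [hpow, map_zero]; exact Submodule.zero_mem _⟩
  | add x y hx hy =>
    obtain ⟨m, hm⟩ := hx
    obtain ⟨m', hm'⟩ := hy
    refine ⟨max m m', fun k hk => ?_⟩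
    rw [hpow, map_add, ← hpow]
    exact Submodule.add_mem _ (hm k (le_of_max_le_left hk)) (hm' k (le_of_max_le_right hk))
  | single σ r =>
    obtain ⟨δ, hδ, h⟩ := hAB.exists_lebesgue_number (cont_ofTopology σ)
    obtain ⟨m, hm⟩ := exists_pow_lt_of_lt_one hδ (by norm_num : (1 / 2 : ℝ) < 1)
    refine ⟨m, fun k hk => ?_⟩
    have hk' := (pow_le_pow_of_le_one (by norm_num : (0 : ℝ) ≤ 1 / 2) (by norm_num) hk).trans_lt hm
    rw [← mul_one r, ← smul_eq_mul, ← Finsupp.smul_single, hpow, map_smul, ← hpow]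
    refine Submodule.smul_mem _ _ (Finsupp.supported_mono ?_ (iterate_subdiv_contractions σ k))
    rintro _ ⟨g, rfl, hg⟩
    -- An arbitrary base point: the cube has diameter at most `1`, so the image of a contraction
    -- lies in a small ball about the image of `o`.
    let o : Fin n → unitInterval := fun _ => 0
    have hball : ∀ a, dist (α := Fin n → unitInterval) (g.toFun a) (g.toFun o) < δ := by
      intro a
      refine lt_of_le_of_lt ((dist_pi_le_iff (X := fun _ : Fin n => unitInterval)
        (by positivity)).2 fun i => (hg a o i).trans ?_) hk'
      refine mul_le_of_le_one_right (by positivity) ((dist_pi_le_iff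
        (X := fun _ : Fin n => unitInterval) zero_le_one).2 fun j => ?_)
      exact Real.dist_le_of_mem_Icc_01 (a j).2 (o j).2
    exact (h (g.toFun o)).imp (fun h a => h _ (hball a)) (fun h a => h _ (hball a))

end CubeChain

/-! ### Mayer–Vietoris for singular cubical homology. -/

theorem hasMayerVietorisSequence_cubicalChains (J : CInterval) {X : Type u} [ClosureSpace X]
    {A B : Set X} (hAB : IsInteriorCover ({A, B} : Set (Set X))) :
    HasMayerVietorisSequence (cubicalChains J) A B := by
  have inj : ∀ {S T : Set X} (h : S ⊆ T) n,
      Function.Injective (CubeChain.map (J := J) (Cl.incl h) n) :=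
    fun h n => Finsupp.mapDomain_injective (CMap.comp_incl_injective h)
  refine hasMayerVietorisSequence_of_acyclic _ A B ?_ ?_ ?_
  · intro n x y h
    exact Subtype.ext (inj _ n (congrArg Subtype.val h))
  · rintro n ⟨a, ha⟩ ⟨b, hb⟩ h
    obtain ⟨x, h₁, h₂⟩ := CMap.exists_of_mapDomain_add_eq_zero (congrArg Subtype.val h)
    refine ⟨⟨x, CubeChain.mem_normalized_of_map (Cl.incl Set.inter_subset_left) (inj _) ?_⟩,
      Subtype.ext h₁, Subtype.ext h₂⟩
    rwa [show CubeChain.map (Cl.incl Set.inter_subset_left) n x = a from h₁]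
  -- If `p` has no neighbourhood but the whole interval, the point with all coordinates `p` lies in
  -- the closure of every singleton of the cube. The end point `1` has this property for `J₊` and
  -- for `J₁`.
  have of_dominated (p : J.space) (hp : ∀ (z : J.space) (U : Set J.space), p ∈ int U → z ∈ U)
      (n : ℕ) (z : ((cubicalChains J).obj (Cl.of X)).X n) :
      ∃ w, z - ((cubicalChains J).obj (Cl.of X)).d (n + 1) n w ∈
        smallChains (cubicalChains J) A B n :=
    ⟨0, CubeChain.mem_smallChains fun σ _ => CMap.mem_small_of_forall_mem_cl hAB (fun _ => p)
      (fun z F V hV => ⟨z, rfl, fun i hi => hp (z i) _ (hV i hi)⟩) σ⟩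
  cases J with
  | Jplus =>
    refine fun n z _ => of_dominated (1 : Fin 2) (fun z U hU => ?_) n z
    by_contra h
    exact hU ⟨z, h, Fin.le_last (z : Fin 2)⟩
  | Jone =>
    refine fun n z _ => of_dominated (1 : Fin 2) (fun z U hU => ?_) n z
    by_contra h
    exact hU ⟨z, h⟩
  | I =>
    refine ChainComplex.acyclic_of_subdivision _
      (fun n (c : CubeChain.normalized .I X n) =>
        (⟨CubeChain.subdiv X n c.1, CubeChain.subdiv_mem c.2⟩ : CubeChain.normalized .I X n))
      (fun n (c : CubeChain.normalized .I X n) =>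
        (⟨CubeChain.homotopy X n c.1, CubeChain.homotopy_mem c.2⟩ :
          CubeChain.normalized .I X (n + 1))) ?_ ?_ ?_ ?_ ?_ ?_
    · intro n x
      refine (CubeChain.d_eq n _).trans (Subtype.ext ?_)
      exact (CubeChain.bdry_subdiv n x.1).trans
        (congrArg (CubeChain.subdiv X n) (congrArg Subtype.val (CubeChain.d_eq n x)).symm)
    · intro x
      exact (CubeChain.d_eq 0 _).trans (Subtype.ext (CubeChain.bdry_homotopy_zero x.1))
    · intro n x
      refine Subtype.ext (Eq.trans ?_ (CubeChain.bdry_homotopy_succ n x.1))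
      exact congrArg₂ (fun a b : CubeChain .I X (n + 1) => a + b)
        (congrArg Subtype.val (CubeChain.d_eq (n + 1) _))
        (congrArg (CubeChain.homotopy X n) (congrArg Subtype.val (CubeChain.d_eq n x)))
    · intro n x hx
      exact CubeChain.mem_smallChains (CubeChain.homotopy_small_mem
        (CubeChain.supported_of_mem_smallChains hx))
    · intro n x hx
      exact CubeChain.mem_smallChains (CubeChain.subdiv_small_mem
        (CubeChain.supported_of_mem_smallChains hx))
    · intro n x
      obtain ⟨m, hm⟩ := CubeChain.exists_iterate_subdiv_mem hAB n x.1
      have hval : ∀ (k : ℕ) (y : CubeChain.normalized .I X n),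
          ((fun c : CubeChain.normalized .I X n => (⟨CubeChain.subdiv X n c.1,
            CubeChain.subdiv_mem c.2⟩ : CubeChain.normalized .I X n))^[k] y).1 =
          (CubeChain.subdiv X n)^[k] y.1 := by
        intro k
        induction k with
        | zero => exact fun _ => rfl
        | succ k ih => exact fun y => ih _
      exact ⟨m, CubeChain.mem_smallChains ((hval m x).symm ▸ hm m le_rfl)⟩

theorem theorem1p4 (J : CInterval) (X : Type u) [ClosureSpace X] (A B : Set X)
    (hAB : IsInteriorCover ({A, B} : Set (Set X))) :
    HasMayerVietorisSequence (simplicialChains J) A B ∧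
      HasMayerVietorisSequence (cubicalChains J) A B :=
  ⟨hasMayerVietorisSequence_simplicialChains J hAB, hasMayerVietorisSequence_cubicalChains J hAB⟩
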